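/- Let $\mathcal H$ be the $\mathbf Q$-vector space with basis the set $\mathcal W$ of all words in two letters $a,b$ (including the empty word $\emptyset$). It is a commutative algebra for the shuffle product $*$, where $w*w'$ is the sum, with multiplicities, of all interleavings of $w$ and $w'$; its unit is $\emptyset$. For $k\ge 1$ and positive integers $r_1,\dots,r_k$ set $$L_{r_1,\dots,r_k}(z)=\sum_{0<n_1<\dots<n_k} n_1^{-r_1}\cdots n_k^{-r_k}\,z^{n_k}\quad(|z|<1),\qquad \zeta(r_1,\dots,r_k)=\sum_{0<n_1<\dots<n_k} n_1^{-r_1}\cdots n_k^{-r_k}\quad (r_k\ge 2).$$ Every non-empty word starting with $a$ is uniquely of the form $w=ab^{r_1-1}\cdots ab^{r_k-1}$ with $k\ge1$ and all $r_i\ge1$, and it ends with $b$ if and only if $r_k\ge 2$; set $L_w=L_{r_1,\dots,r_k}$ and, if $r_k\geq 2$, $\zeta(w)=\zeta(r_1,\dots,r_k)$. Let $\Omega=\{z\in\mathbf C: |z|<1\}\setminus\,]-1,0]$, and let $\log$ be the holomorphic logarithm on $\Omega$ that is real on $]0,1[$. There is a unique morphism of $\mathbf Q$-algebras $h\mapsto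 L_h$ from $(\mathcal H,*)$ to the algebra of holomorphic functions on $\Omega$ that sends each non-empty word $w$ starting with $a$ to $L_w$ and sends $b$ to $\log z$. For each $\theta\in\{0,i\pi,-i\pi\}$ there is a unique morphism of $\mathbf Q$-algebras $(\mathcal H,*)\to\mathbf C$ that sends each word $w$ starting with $a$ and ending with $b$ to $\zeta(w)$, and sends $a$ to $\theta$ and $b$ to $0$; denote it by $\zeta$, $\zeta^+$, $\zeta^-$ for $\theta=0$, $i\pi$, $-i\pi$ respectively. Let $\Delta:\mathcal H\to\mathcal H\otimes\mathcal H$ be the linear map with $\Delta(c_1\cdots c_n)=\sum_{0\le i\le n}c_1\cdots c_i\otimes c_{i+1}\cdots c_n$ for letters $c_1,\dots,c_n$. Set $\sigma(a)=b$, $\sigma(b)=a$, $\tau(a)=a+b$, $\tau(b)=-a$, and let $\sigma,\tau:\mathcal H\to\mathcal H$ be the linear maps with $\sigma(c_1\cdots c_n)=\sigma(c_n)\cdots\sigma(c_1)$ and $\tau(c_1\cdots c_n)=\tau(c_n)\cdots\tau(c_1)$ (concatenation products). Define $\Box,\nabla:\mathcal H\to\mathcal H$ as the composites $$\Box:\mathcal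 H\xrightarrow{\Delta}\mathcal H\otimes\mathcal H\xrightarrow{\mathrm{id}\otimes\sigma}\mathcal H\otimes\mathcal H\xrightarrow{*}\mathcal H,\qquad \nabla:\mathcal H\xrightarrow{\Delta}\mathcal H\otimes\mathcal H\xrightarrow{\mathrm{id}\otimes\tau}\mathcal H\otimes\mathcal H\xrightarrow{*}\mathcal H.$$ Let $\rho=e^{i\pi/3}$. Theorem. For every $h\in\mathcal H$, $$\zeta(h)=L_{\Box(h)}(1/2);$$ moreover $L_{\nabla(h)}$ extends continuously from $\Omega$ to the boundary points $\rho$ and $\rho^{-1}$, and the extended values satisfy $$\zeta^{+}(h)=L_{\nabla(h)}(\rho),\qquad \zeta^{-}(h)=L_{\nabla(h)}(\rho^{-1}).$$ -/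

import Mathlib

open scoped TensorProduct Topology

noncomputable section

namespace Polyzeta

/-- The two letters. -/
inductive Letter
  | a
  | b

/-- Words in the letters `a` and `b`; the empty word is `[]`. -/
abbrev Word := List Letter

/-- The rational vector space with basis the set of all words. -/
abbrev H := Word →₀ ℚ

/-- A word, as an element of `H`. -/
def word (w : Word) : H := Finsupp.single w 1

/-- A letter, as an element of `H`. -/
def letter (c : Letter) : H := word [c]

/-! ### Shuffle product and concatenation product -/

/-- Left multiplication of words by a letter, extended linearly. -/
def consMap (c : Letter) : H →ₗ[ℚ] H := Finsupp.lmapDomain ℚ ℚ (List.cons c)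

/-- The shuffle product of two words: the sum, with multiplicities, of all their interleavings. -/
def shuffleWord : Word → Word → H
  | [], v => word v
  | x :: u, [] => word (x :: u)
  | x :: u, y :: v => consMap x (shuffleWord u (y :: v)) + consMap y (shuffleWord (x :: u) v)
termination_by u v => u.length + v.length

/-- The shuffle product on `H`. -/
def shuffle : H →ₗ[ℚ] H →ₗ[ℚ] H :=
  Finsupp.linearCombination ℚ fun u => Finsupp.linearCombination ℚ fun v => shuffleWord u v

/-- The concatenation product on `H`. -/
def concat : H →ₗ[ℚ] H →ₗ[ℚ] H :=
  Finsupp.linearCombination ℚ fun u => Finsupp.linearCombination ℚ fun v => word (u ++ v)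

/-! ### Coproduct and the maps `σ`, `τ`, `□`, `∇` -/

/-- The deconcatenation coproduct,
`c₁ ⋯ cₙ ↦ ∑_{0 ≤ i ≤ n} c₁ ⋯ cᵢ ⊗ cᵢ₊₁ ⋯ cₙ`. -/
def coproduct : H →ₗ[ℚ] H ⊗[ℚ] H :=
  Finsupp.linearCombination ℚ fun w =>
    ∑ i ∈ Finset.range (w.length + 1), word (w.take i) ⊗ₜ[ℚ] word (w.drop i)

/-- `c₁ ⋯ cₙ ↦ f(cₙ) ⋯ f(c₁)` (concatenation product) on words. -/
def antiWord (f : Letter → H) : Word → H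
  | [] => word []
  | c :: w => concat (antiWord f w) (f c)

/-- The linear map `H → H` with `c₁ ⋯ cₙ ↦ f(cₙ) ⋯ f(c₁)`. -/
def antiExtend (f : Letter → H) : H →ₗ[ℚ] H := Finsupp.linearCombination ℚ (antiWord f)

/-- `σ(a) = b`, `σ(b) = a` on letters. -/
def sigmaLetter : Letter → H
  | .a => letter .b
  | .b => letter .a

/-- `τ(a) = a + b`, `τ(b) = -a` on letters. -/
def tauLetter : Letter → H
  | .a => letter .a + letter .b
  | .b => -letter .a

/-- The map `σ`. -/
def sigma : H →ₗ[ℚ] H := antiExtend sigmaLetter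

/-- The map `τ`. -/
def tau : H →ₗ[ℚ] H := antiExtend tauLetter

/-- `□ = * ∘ (id ⊗ σ) ∘ Δ`. -/
def boxMap : H →ₗ[ℚ] H :=
  TensorProduct.lift shuffle ∘ₗ TensorProduct.map LinearMap.id sigma ∘ₗ coproduct

/-- `∇ = * ∘ (id ⊗ τ) ∘ Δ`. -/
def nablaMap : H →ₗ[ℚ] H :=
  TensorProduct.lift shuffle ∘ₗ TensorProduct.map LinearMap.id tau ∘ₗ coproduct

/-! ### The series -/

/-- The index set `0 < n₁ < ⋯ < nₖ₊₁`. -/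
def Indices (k : ℕ) : Type := {n : Fin (k + 1) → ℕ // 0 < n 0 ∧ StrictMono n}

/-- `L_{r₁,…,rₖ₊₁}(z) = ∑_{0 < n₁ < ⋯ < nₖ₊₁} n₁^{-r₁} ⋯ nₖ₊₁^{-rₖ₊₁} z^{nₖ₊₁}`
(absolutely convergent for `|z| < 1`). -/
def polylogSeries {k : ℕ} (r : Fin (k + 1) → ℕ+) (z : ℂ) : ℂ :=
  ∑' n : Indices k, (∏ i, ((n.1 i : ℂ) ^ (r i : ℕ))⁻¹) * z ^ n.1 (Fin.last k)

/-- `ζ(r₁,…,rₖ₊₁) = ∑_{0 < n₁ < ⋯ < nₖ₊₁} n₁^{-r₁} ⋯ nₖ₊₁^{-rₖ₊₁}`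
(absolutely convergent for `rₖ₊₁ ≥ 2`). -/
def polyzetaSeries {k : ℕ} (r : Fin (k + 1) → ℕ+) : ℂ :=
  ∑' n : Indices k, ∏ i, ((n.1 i : ℂ) ^ (r i : ℕ))⁻¹

/-- The word `a b^{r₁ - 1} a b^{r₂ - 1} ⋯ a b^{rₖ₊₁ - 1}`. Every non-empty word that starts with
`a` has this form for exactly one sequence `r`, and it ends with `b` if and only if
`rₖ₊₁ ≥ 2`. -/
def seqWord {k : ℕ} (r : Fin (k + 1) → ℕ+) : Word :=
  (List.ofFn r).flatMap fun s => Letter.a :: List.replicate ((s : ℕ) - 1) Letter.b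

/-! ### Polylogarithms -/

/-- `Ω`: the open unit disc without `]-1, 0]`. -/
def Omega : Set ℂ := Metric.ball 0 1 ∩ Complex.slitPlane

/-- The algebra of holomorphic functions on `U`, as functions on the subtype `U`. -/
def Hol (U : Set ℂ) : Subalgebra ℂ (U → ℂ) where
  carrier := {f | ∃ F : ℂ → ℂ, DifferentiableOn ℂ F U ∧ ∀ z : U, f z = F z}
  mul_mem' := by
    rintro f g ⟨F, hF, hf⟩ ⟨G, hG, hg⟩
    exact ⟨fun z => F z * G z, hF.mul hG, fun z => by simp [hf, hg]⟩
  add_mem' := by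
    rintro f g ⟨F, hF, hf⟩ ⟨G, hG, hg⟩
    exact ⟨fun z => F z + G z, hF.add hG, fun z => by simp [hf, hg]⟩
  algebraMap_mem' := fun c => ⟨fun _ => c, differentiableOn_const c, fun _ => rfl⟩

/-- `Φ` is a morphism of `ℚ`-algebras from `H`, with the shuffle product, to `A`. -/
def IsShuffleMorphism {A : Type*} [Semiring A] [Module ℚ A] (Φ : H →ₗ[ℚ] A) : Prop :=
  Φ (word []) = 1 ∧ ∀ u v : H, Φ (shuffle u v) = Φ u * Φ v

/-- The requirements that determine the morphism `h ↦ L_h` from `H` to the holomorphic functions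
on `Ω`: it is an algebra morphism, it sends every non-empty word that starts with `a` to the
corresponding series, and it sends `b` to the logarithm. -/
def IsPolylogMorphism (Φ : H →ₗ[ℚ] Hol Omega) : Prop :=
  IsShuffleMorphism Φ ∧
  (∀ (k : ℕ) (r : Fin (k + 1) → ℕ+) (z : Omega),
    (Φ (word (seqWord r))).1 z = polylogSeries r z) ∧
  ∀ z : Omega, (Φ (letter .b)).1 z = Complex.log z

/-- The morphism `h ↦ L_h`, as a holomorphic function on `Ω`. -/
def polylog : H →ₗ[ℚ] Hol Omega := Classical.epsilon IsPolylogMorphism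

open Classical in
/-- The value `L_h(z)`: for `z ∈ Ω` the value of the holomorphic function `L_h`, and at a
boundary point the value of its continuous extension, that is, its limit from within `Ω`. -/
def L (h : H) (z : ℂ) : ℂ :=
  if hz : z ∈ Omega then (polylog h).1 ⟨z, hz⟩
  else Filter.limUnder (Filter.comap ((↑) : Omega → ℂ) (𝓝 z)) (polylog h).1

/-! ### Polyzeta values -/

/-- The requirements that determine a regularized polyzeta morphism `H → ℂ`: it is an algebra
morphism, it sends every word that starts with `a` and ends with `b` to the corresponding
convergent series, it sends `a` to `θ` and `b` to `0`. -/
def IsZetaMorphism (θ : ℂ) (ψ : H →ₗ[ℚ] ℂ) : Prop :=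
  IsShuffleMorphism ψ ∧
  (∀ (k : ℕ) (r : Fin (k + 1) → ℕ+), 2 ≤ r (Fin.last k) →
    ψ (word (seqWord r)) = polyzetaSeries r) ∧
  ψ (letter .a) = θ ∧ ψ (letter .b) = 0

/-- `ζ : H → ℂ`, with `ζ(a) = 0`. -/
def zeta : H →ₗ[ℚ] ℂ := Classical.epsilon (IsZetaMorphism 0)

/-- `ζ⁺ : H → ℂ`, with `ζ⁺(a) = iπ`. -/
def zetaPlus : H →ₗ[ℚ] ℂ := Classical.epsilon (IsZetaMorphism (Complex.I * Real.pi))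

/-- `ζ⁻ : H → ℂ`, with `ζ⁻(a) = -iπ`. -/
def zetaMinus : H →ₗ[ℚ] ℂ := Classical.epsilon (IsZetaMorphism (-(Complex.I * Real.pi)))

/-- `ρ = e^{iπ/3}`. -/
def rho : ℂ := Complex.exp (Complex.I * Real.pi / 3)

end Polyzeta

end

noncomputable section

namespace Polyzeta

/-! ### Linear algebra on words -/

/-! Put `ω_a = dz/(1-z)` and `ω_b = dz/z`. The values `L_w(z)` form a functional on words whose
derivative deletes the last letter `c` and multiplies by `ω_c`. Deleting the first or last letter is
a derivation of the shuffle product, so a solution of such an equation with the right initial value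
is a shuffle morphism (`isShuffleMorphism_of_hasDerivAt`). Existence comes from the factorization
`polylogChar = exp(b log z) · M(z)`, the product being convolution for deconcatenation: `M` is
holomorphic on the whole disc with value 1 at 0, and all logarithms sit in the first factor.

The substitutions `φ(z) = 1 - z` and `φ(z) = 1 - 1/z` carry the form attached to `σ(c)`,
respectively `τ(c)`, to `-ω_c`. Since `σ` and `τ` reverse words, the functional `L(φ(z)) ∘ σ` (or `∘
τ`) has a derivative that deletes the first letter, with a minus sign. In the convolution with
`L(z)` the two derivatives cancel (`conv_deleteLast_left`), so the convolution is constant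
(`hasDerivAt_conv_pullback`). On a word `a⋯b` the constant is found by letting `z → 1`, where `φ(z)
→ 0`: the term with empty second factor tends to `ζ(w)`, and every other term is a slowly growing
factor times one that is `O(φ(z))` (`conv_pullback_seqWord`).

Evaluation at the fixed point of `φ`, namely `1/2` or `ρ^{±1}`, turns this convolution into `L ∘ □`
or `L ∘ ∇`. It is a shuffle morphism with the right values on `a`, on `b` and on the words `a⋯b`,
and these data generate the shuffle algebra (`IsShuffleMorphism.ext_startA_endB`). The points
`ρ^{±1}` lie on the unit circle, so there the values are limits; they exist because each `L_w` is
Lipschitz nearby (`lipschitz_polylogChar`). -/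

instance : DecidableEq Letter
  | .a, .a => isTrue rfl
  | .a, .b => isFalse nofun
  | .b, .a => isFalse nofun
  | .b, .b => isTrue rfl

theorem hom_ext_word {M : Type*} [AddCommMonoid M] [Module ℚ M] {f g : H →ₗ[ℚ] M}
    (h : ∀ w, f (word w) = g (word w)) : f = g :=
  Finsupp.lhom_ext' fun w => LinearMap.ext_ring (h w)

@[simp]
theorem linearCombination_word {M : Type*} [AddCommMonoid M] [Module ℚ M] (f : Word → M)
    (w : Word) : Finsupp.linearCombination ℚ f (word w) = f w := by
  simp [word]

@[elab_as_elim]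
theorem induction_word {P : H → Prop} (h : H) (h0 : P 0) (hw : ∀ w, P (word w))
    (hadd : ∀ x y, P x → P y → P (x + y)) (hsmul : ∀ (q : ℚ) x, P x → P (q • x)) : P h := by
  induction h using Finsupp.induction_linear with
  | zero => exact h0
  | add x y hx hy => exact hadd x y hx hy
  | single w q =>
    have : Finsupp.single w q = q • word w := by simp [word]
    rw [this]
    exact hsmul q _ (hw w)

/-- Right multiplication of words by a letter, extended linearly. -/
def snocMap (c : Letter) : H →ₗ[ℚ] H := Finsupp.lmapDomain ℚ ℚ (fun w => w ++ [c])

@[simp]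
theorem consMap_word (c : Letter) (w : Word) : consMap c (word w) = word (c :: w) := by
  simp [consMap, word]

@[simp]
theorem snocMap_word (c : Letter) (w : Word) : snocMap c (word w) = word (w ++ [c]) := by
  simp [snocMap, word]

theorem snocMap_consMap (c d : Letter) (h : H) :
    snocMap c (consMap d h) = consMap d (snocMap c h) := by
  have : snocMap c ∘ₗ consMap d = consMap d ∘ₗ snocMap c := hom_ext_word fun w => by simp
  exact LinearMap.congr_fun this h

@[simp]
theorem shuffle_word (u v : Word) : shuffle (word u) (word v) = shuffleWord u v := by
  simp [shuffle]

@[simp]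
theorem shuffleWord_nil_left (v : Word) : shuffleWord [] v = word v := by
  simp [shuffleWord]

@[simp]
theorem shuffleWord_nil_right (v : Word) : shuffleWord v [] = word v := by
  cases v <;> simp [shuffleWord]

theorem shuffleWord_cons_cons (x y : Letter) (u v : Word) :
    shuffleWord (x :: u) (y :: v) =
      consMap x (shuffleWord u (y :: v)) + consMap y (shuffleWord (x :: u) v) := by
  rw [shuffleWord]

/-- The shuffle is defined by recursion on first letters, while differentiation acts on last
letters. The two recursions are compatible because adding a letter in front commutes with adding one
at the end. -/
theorem shuffleWord_snoc_snoc (c d : Letter) : ∀ u v : Word,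
    shuffleWord (u ++ [c]) (v ++ [d]) =
      snocMap c (shuffleWord u (v ++ [d])) + snocMap d (shuffleWord (u ++ [c]) v)
  | [], [] => by
    simp [shuffleWord_cons_cons, add_comm]
  | [], y :: v => by
    have ih := shuffleWord_snoc_snoc c d [] v
    simp only [List.nil_append, List.cons_append, shuffleWord_nil_left] at ih ⊢
    rw [shuffleWord_cons_cons, ih, shuffleWord_cons_cons]
    simp only [map_add, snocMap_consMap, shuffleWord_nil_left, snocMap_word, consMap_word,
      List.cons_append]
    abel
  | x :: u, [] => by
    have ih := shuffleWord_snoc_snoc c d u []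
    simp only [List.nil_append, List.cons_append, shuffleWord_nil_right] at ih ⊢
    rw [shuffleWord_cons_cons, ih, shuffleWord_cons_cons]
    simp only [map_add, snocMap_consMap, shuffleWord_nil_right, snocMap_word, consMap_word,
      List.cons_append]
    abel
  | x :: u, y :: v => by
    have ih₁ := shuffleWord_snoc_snoc c d u (y :: v)
    have ih₂ := shuffleWord_snoc_snoc c d (x :: u) v
    simp only [List.cons_append] at ih₁ ih₂ ⊢
    rw [shuffleWord_cons_cons, ih₁, ih₂, shuffleWord_cons_cons, shuffleWord_cons_cons]
    simp only [map_add, snocMap_consMap]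
    abel
termination_by u v => u.length + v.length

theorem bilin_ext_word {M : Type*} [AddCommMonoid M] [Module ℚ M] {f g : H →ₗ[ℚ] H →ₗ[ℚ] M}
    (h : ∀ u v, f (word u) (word v) = g (word u) (word v)) : f = g :=
  hom_ext_word fun u => hom_ext_word fun v => h u v

theorem shuffle_snocMap_snocMap (c d : Letter) (h k : H) :
    shuffle (snocMap c h) (snocMap d k) =
      snocMap c (shuffle h (snocMap d k)) + snocMap d (shuffle (snocMap c h) k) := by
  have : shuffle.compl₁₂ (snocMap c) (snocMap d) =
      (shuffle.compl₁₂ LinearMap.id (snocMap d)).compr₂ (snocMap c) +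
        (shuffle.compl₁₂ (snocMap c) LinearMap.id).compr₂ (snocMap d) :=
    bilin_ext_word fun u v => by simp [shuffleWord_snoc_snoc]
  simpa using LinearMap.congr_fun₂ this h k

@[simp]
theorem shuffle_nil_left (h : H) : shuffle (word []) h = h := by
  have : shuffle (word []) = LinearMap.id := hom_ext_word fun w => by simp
  simp [this]

@[simp]
theorem shuffle_nil_right (h : H) : shuffle h (word []) = h := by
  have : shuffle.flip (word []) = LinearMap.id := hom_ext_word fun w => by simp
  exact LinearMap.congr_fun this h

/-! ### Deletion of the first and of the last letter -/

/-- Deletion of the first letter, if it is `c`. -/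
def deleteHead (c : Letter) : H →ₗ[ℚ] H :=
  Finsupp.linearCombination ℚ fun w => if w.head? = some c then word w.tail else 0

/-- Deletion of the last letter, if it is `c`. -/
def deleteLast (c : Letter) : H →ₗ[ℚ] H :=
  Finsupp.linearCombination ℚ fun w => if w.getLast? = some c then word w.dropLast else 0

@[simp]
theorem deleteHead_nil (c : Letter) : deleteHead c (word []) = 0 := by simp [deleteHead]

@[simp]
theorem deleteHead_cons (c d : Letter) (w : Word) :
    deleteHead c (word (d :: w)) = if d = c then word w else 0 := by simp [deleteHead]

@[simp]
theorem deleteLast_nil (c : Letter) : deleteLast c (word []) = 0 := by simp [deleteLast]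

@[simp]
theorem deleteLast_snoc (c d : Letter) (w : Word) :
    deleteLast c (word (w ++ [d])) = if d = c then word w else 0 := by simp [deleteLast]

theorem deleteHead_consMap (c d : Letter) (h : H) :
    deleteHead c (consMap d h) = if d = c then h else 0 := by
  have : deleteHead c ∘ₗ consMap d = if d = c then LinearMap.id else 0 :=
    hom_ext_word fun w => by split_ifs <;> simp [*]
  have := LinearMap.congr_fun this h
  split_ifs at this ⊢ <;> simpa using this

theorem deleteLast_snocMap (c d : Letter) (h : H) :
    deleteLast c (snocMap d h) = if d = c then h else 0 := by
  have : deleteLast c ∘ₗ snocMap d = if d = c then LinearMap.id else 0 :=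
    hom_ext_word fun w => by split_ifs <;> simp [*]
  have := LinearMap.congr_fun this h
  split_ifs at this ⊢ <;> simpa using this

/-- `D` is a derivation of the shuffle product. -/
def IsShuffleDerivation (D : H →ₗ[ℚ] H) : Prop :=
  ∀ u v : Word, D (shuffleWord u v) = shuffle (D (word u)) (word v) + shuffle (word u) (D (word v))

theorem isShuffleDerivation_deleteHead (c : Letter) : IsShuffleDerivation (deleteHead c) := by
  intro u v
  rcases u with _ | ⟨x, u⟩
  · simp
  rcases v with _ | ⟨y, v⟩
  · simp
  rw [shuffleWord_cons_cons, map_add, deleteHead_consMap, deleteHead_consMap, deleteHead_cons,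
    deleteHead_cons]
  split_ifs <;> simp

/-- The last letter of an interleaving is the last letter of one of the two words, so the recursion
from the right is the Leibniz rule. -/
theorem isShuffleDerivation_deleteLast (c : Letter) : IsShuffleDerivation (deleteLast c) := by
  intro u v
  rcases List.eq_nil_or_concat u with rfl | ⟨u, x, rfl⟩
  · simp
  rcases List.eq_nil_or_concat v with rfl | ⟨v, y, rfl⟩
  · simp
  simp only [List.concat_eq_append]
  rw [shuffleWord_snoc_snoc, map_add, deleteLast_snocMap, deleteLast_snocMap, deleteLast_snoc,
    deleteLast_snoc]
  split_ifs <;> simp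

theorem IsShuffleDerivation.sub {D E : H →ₗ[ℚ] H} (hD : IsShuffleDerivation D)
    (hE : IsShuffleDerivation E) : IsShuffleDerivation (D - E) := by
  intro u v
  simp only [LinearMap.sub_apply, hD u v, hE u v, map_sub]
  abel

/-- The linear map `D` strictly lowers the length of words. -/
def LowersLength (D : H →ₗ[ℚ] H) : Prop :=
  ∀ w : Word, D (word w) ∈ Submodule.span ℚ (word '' {v | v.length < w.length})

theorem lowersLength_deleteHead (c : Letter) : LowersLength (deleteHead c) := by
  rintro (_ | ⟨x, u⟩)
  · simp
  rw [deleteHead_cons]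
  split_ifs
  · exact Submodule.subset_span ⟨u, by simp, rfl⟩
  · exact zero_mem _

theorem lowersLength_deleteLast (c : Letter) : LowersLength (deleteLast c) := by
  intro u
  rcases List.eq_nil_or_concat u with rfl | ⟨u, x, rfl⟩
  · simp
  rw [List.concat_eq_append, deleteLast_snoc]
  split_ifs
  · exact Submodule.subset_span ⟨u, by simp, rfl⟩
  · exact zero_mem _

theorem LowersLength.sub {D E : H →ₗ[ℚ] H} (hD : LowersLength D) (hE : LowersLength E) :
    LowersLength (D - E) := fun w => Submodule.sub_mem _ (hD w) (hE w)

/-! ### Convolution of linear functionals -/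

section Convolution

variable {A : Type*} [CommRing A]

/-- The sum of `f p q` over all factorizations of a word as `p ++ q`. -/
def splitSum (f : Word → Word → A) : Word → A
  | [] => f [] []
  | x :: w => f [] (x :: w) + splitSum (fun p q => f (x :: p) q) w

theorem splitSum_eq_sum (f : Word → Word → A) (w : Word) :
    splitSum f w = ∑ i ∈ Finset.range (w.length + 1), f (w.take i) (w.drop i) := by
  induction w generalizing f with
  | nil => simp [splitSum]
  | cons x w ih =>
    rw [splitSum, ih, List.length_cons, Finset.sum_range_succ' _ (w.length + 1)]
    simp [add_comm]

theorem splitSum_add (f g : Word → Word → A) (w : Word) :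
    splitSum (fun p q => f p q + g p q) w = splitSum f w + splitSum g w := by
  simp [splitSum_eq_sum, Finset.sum_add_distrib]

theorem splitSum_mul (f : Word → A) (g : Word → A) (f' : Word → A) (g' : Word → A) (u v : Word) :
    splitSum (fun p q => splitSum (fun p' q' => (f p * f' p') * (g q * g' q')) v) u =
      splitSum (fun p q => f p * g q) u * splitSum (fun p q => f' p * g' q) v := by
  simp only [splitSum_eq_sum, Finset.sum_mul_sum]
  exact Finset.sum_congr rfl fun i _ => Finset.sum_congr rfl fun j _ => by ring

variable [Algebra ℚ A]

/-- The convolution of two linear functionals for the deconcatenation coproduct. -/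
def conv (F G : H →ₗ[ℚ] A) : H →ₗ[ℚ] A :=
  Finsupp.linearCombination ℚ (splitSum fun p q => F (word p) * G (word q))

theorem conv_word (F G : H →ₗ[ℚ] A) (w : Word) :
    conv F G (word w) = splitSum (fun p q => F (word p) * G (word q)) w := by
  simp [conv]

theorem conv_word_eq_sum (F G : H →ₗ[ℚ] A) (w : Word) : conv F G (word w) =
    ∑ i ∈ Finset.range (w.length + 1), F (word (w.take i)) * G (word (w.drop i)) := by
  rw [conv_word, splitSum_eq_sum]

theorem conv_consMap (F G : H →ₗ[ℚ] A) (x : Letter) (h : H) : conv F G (consMap x h) =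
    F (word []) * G (consMap x h) + conv (F ∘ₗ consMap x) G h := by
  have : conv F G ∘ₗ consMap x =
      LinearMap.mulLeft ℚ (F (word [])) ∘ₗ G ∘ₗ consMap x + conv (F ∘ₗ consMap x) G :=
    hom_ext_word fun w => by simp [conv_word, splitSum]
  simpa using LinearMap.congr_fun this h

/-- The bialgebra identity `Δ(u * v) = Δ(u) * Δ(v)`, tested against `F ⊗ G`. It is stated for all
`F` because the recursion replaces `F` by `F ∘ₗ consMap x`. -/
theorem conv_shuffleWord (F G : H →ₗ[ℚ] A) (u v : Word) : conv F G (shuffleWord u v) =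
    splitSum (fun p q => splitSum (fun p' q' =>
      F (shuffleWord p p') * G (shuffleWord q q')) v) u := by
  match u, v with
  | [], v => simp [conv_word, splitSum]
  | x :: u, [] => simp [conv_word, splitSum]
  | x :: u, y :: v =>
    rw [shuffleWord_cons_cons, map_add, conv_consMap, conv_consMap,
      conv_shuffleWord _ G u (y :: v), conv_shuffleWord _ G (x :: u) v]
    simp only [splitSum, LinearMap.comp_apply, shuffleWord_nil_left, shuffleWord_nil_right,
      consMap_word, shuffleWord_cons_cons, map_add, add_mul, mul_add, splitSum_add]
    ring
termination_by u.length + v.length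

theorem IsShuffleMorphism.of_word {F : H →ₗ[ℚ] A} (h1 : F (word []) = 1)
    (h : ∀ u v, F (shuffleWord u v) = F (word u) * F (word v)) : IsShuffleMorphism F := by
  refine ⟨h1, fun u v => ?_⟩
  have : shuffle.compr₂ F = (LinearMap.mul ℚ A).compl₁₂ F F :=
    bilin_ext_word fun u v => by simp [h]
  simpa using LinearMap.congr_fun₂ this u v

theorem IsShuffleMorphism.map_shuffleWord {F : H →ₗ[ℚ] A} (h : IsShuffleMorphism F) (u v : Word) :
    F (shuffleWord u v) = F (word u) * F (word v) := by
  rw [← shuffle_word, h.2]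

theorem IsShuffleMorphism.conv {F G : H →ₗ[ℚ] A} (hF : IsShuffleMorphism F)
    (hG : IsShuffleMorphism G) : IsShuffleMorphism (conv F G) := by
  refine .of_word (by simp [conv_word, splitSum, hF.1, hG.1]) fun u v => ?_
  simp only [conv_shuffleWord, hF.map_shuffleWord, hG.map_shuffleWord, splitSum_mul, conv_word]

/-- Both sides sum `F p * G q` over the factorizations `w = p c q`: the distinguished letter may be
counted with either factor. All the cancellations of derivatives come from this. -/
theorem conv_deleteLast_left (F G : H →ₗ[ℚ] A) (c : Letter) :
    conv (F ∘ₗ deleteLast c) G = conv F (G ∘ₗ deleteHead c) := by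
  refine hom_ext_word fun w => ?_
  rw [conv_word_eq_sum, conv_word_eq_sum, Finset.sum_range_succ', Finset.sum_range_succ]
  simp only [List.take_zero, LinearMap.comp_apply, deleteLast_nil, List.drop_length, map_zero,
    deleteHead_nil, zero_mul, mul_zero, add_zero]
  refine Finset.sum_congr rfl fun i hi => ?_
  have hi' : i < w.length := Finset.mem_range.1 hi
  rw [List.take_succ_eq_append_getElem hi', List.drop_eq_getElem_cons hi', deleteLast_snoc,
    deleteHead_cons]
  split_ifs <;> simp

theorem conv_deleteLast_right (F G : H →ₗ[ℚ] A) (c : Letter) :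
    conv F (G ∘ₗ deleteLast c) = conv F G ∘ₗ deleteLast c := by
  refine hom_ext_word fun w => ?_
  rcases List.eq_nil_or_concat w with rfl | ⟨w, d, rfl⟩
  · simp [conv_word, splitSum]
  rw [List.concat_eq_append, LinearMap.comp_apply, deleteLast_snoc, conv_word_eq_sum,
    List.length_append, List.length_singleton, Finset.sum_range_succ]
  have h : ∀ i ∈ Finset.range (w.length + 1),
      F (word ((w ++ [d]).take i)) * (G ∘ₗ deleteLast c) (word ((w ++ [d]).drop i)) =
      if d = c then F (word (w.take i)) * G (word (w.drop i)) else 0 := by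
    intro i hi
    have hi' : i ≤ w.length := Nat.lt_succ_iff.1 (Finset.mem_range.1 hi)
    rw [List.take_append_of_le_length hi', List.drop_append_of_le_length hi',
      LinearMap.comp_apply, deleteLast_snoc]
    split_ifs <;> simp
  rw [Finset.sum_congr rfl h]
  split_ifs
  · simp [conv_word_eq_sum]
  · simp

theorem conv_add_left (F F' G : H →ₗ[ℚ] A) : conv (F + F') G = conv F G + conv F' G :=
  hom_ext_word fun w => by simp [conv_word_eq_sum, add_mul, Finset.sum_add_distrib]

theorem conv_add_right (F G G' : H →ₗ[ℚ] A) : conv F (G + G') = conv F G + conv F G' :=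
  hom_ext_word fun w => by simp [conv_word_eq_sum, mul_add, Finset.sum_add_distrib]

theorem conv_smul_left (r : A) (F G : H →ₗ[ℚ] A) : conv (r • F) G = r • conv F G :=
  hom_ext_word fun w => by simp [conv_word_eq_sum, Finset.mul_sum, mul_assoc]

theorem conv_smul_right (r : A) (F G : H →ₗ[ℚ] A) : conv F (r • G) = r • conv F G :=
  hom_ext_word fun w => by simp [conv_word_eq_sum, Finset.mul_sum, mul_left_comm]

/-- A shuffle morphism applied to `* ∘ (id ⊗ S) ∘ Δ`. -/
theorem map_lift_shuffle_coproduct {F : H →ₗ[ℚ] A} (hF : IsShuffleMorphism F) (S : H →ₗ[ℚ] H)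
    (h : H) :
    F ((TensorProduct.lift shuffle ∘ₗ TensorProduct.map LinearMap.id S ∘ₗ coproduct) h) =
      conv F (F ∘ₗ S) h := by
  have : F ∘ₗ (TensorProduct.lift shuffle ∘ₗ TensorProduct.map LinearMap.id S ∘ₗ coproduct) =
      conv F (F ∘ₗ S) :=
    hom_ext_word fun w => by simp [conv_word_eq_sum, coproduct, hF.2]
  exact LinearMap.congr_fun this h

end Convolution

/-! ### Anti-morphisms for concatenation that are linear in the letters -/

section AntiExtend

variable {f : Letter → H} {α β : Letter → ℚ}

theorem concat_letter (h : H) (c : Letter) : concat h (letter c) = snocMap c h := by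
  have : concat.flip (letter c) = snocMap c := hom_ext_word fun w => by simp [concat, letter]
  exact LinearMap.congr_fun this h

@[simp]
theorem antiExtend_nil (f : Letter → H) : antiExtend f (word []) = word [] := by
  simp [antiExtend, antiWord]

theorem antiExtend_consMap (hf : ∀ c, f c = α c • letter .a + β c • letter .b) (c : Letter)
    (h : H) : antiExtend f (consMap c h) =
      α c • snocMap .a (antiExtend f h) + β c • snocMap .b (antiExtend f h) := by
  have : antiExtend f ∘ₗ consMap c = (α c • snocMap .a + β c • snocMap .b) ∘ₗ antiExtend f :=
    hom_ext_word fun w => by simp [antiExtend, antiWord, hf c, concat_letter]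
  simpa using LinearMap.congr_fun this h

/-- Reversal turns the recursion on first letters into the one on last letters, and a substitution
that is linear in the letters respects both. -/
theorem antiExtend_shuffleWord (hf : ∀ c, f c = α c • letter .a + β c • letter .b) (u v : Word) :
    antiExtend f (shuffleWord u v) = shuffle (antiExtend f (word u)) (antiExtend f (word v)) := by
  match u, v with
  | [], v => simp
  | x :: u, [] => simp
  | x :: u, y :: v =>
    rw [shuffleWord_cons_cons, map_add, antiExtend_consMap hf, antiExtend_consMap hf,
      antiExtend_shuffleWord hf u (y :: v), antiExtend_shuffleWord hf (x :: u) v,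
      ← consMap_word x u, ← consMap_word y v, antiExtend_consMap hf, antiExtend_consMap hf]
    simp only [map_add, map_smul, LinearMap.add_apply, LinearMap.smul_apply,
      shuffle_snocMap_snocMap, smul_add]
    simp only [smul_comm (α x), smul_comm (β x)]
    abel
termination_by u.length + v.length

theorem IsShuffleMorphism.comp_antiExtend {A : Type*} [CommRing A] [Algebra ℚ A]
    {F : H →ₗ[ℚ] A} (hF : IsShuffleMorphism F)
    (hf : ∀ c, f c = α c • letter .a + β c • letter .b) :
    IsShuffleMorphism (F ∘ₗ antiExtend f) :=
  .of_word (by simp [hF.1]) fun u v => by simp [antiExtend_shuffleWord hf, hF.2]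

theorem deleteLast_a_comp_antiExtend (hf : ∀ c, f c = α c • letter .a + β c • letter .b) :
    deleteLast .a ∘ₗ antiExtend f =
      α .a • antiExtend f ∘ₗ deleteHead .a + α .b • antiExtend f ∘ₗ deleteHead .b := by
  refine hom_ext_word ?_
  rintro (_ | ⟨c, w⟩)
  · simp
  rw [← consMap_word, LinearMap.comp_apply, antiExtend_consMap hf]
  cases c <;> simp [deleteLast_snocMap, deleteHead_consMap, -consMap_word]

theorem deleteLast_b_comp_antiExtend (hf : ∀ c, f c = α c • letter .a + β c • letter .b) :
    deleteLast .b ∘ₗ antiExtend f =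
      β .a • antiExtend f ∘ₗ deleteHead .a + β .b • antiExtend f ∘ₗ deleteHead .b := by
  refine hom_ext_word ?_
  rintro (_ | ⟨c, w⟩)
  · simp
  rw [← consMap_word, LinearMap.comp_apply, antiExtend_consMap hf]
  cases c <;> simp [deleteLast_snocMap, deleteHead_consMap, -consMap_word]

/-- The span of the words that start with `a`. -/
def spanStartA : Submodule ℚ H := Submodule.span ℚ (Set.range fun v => word (.a :: v))

theorem snocMap_mem_spanStartA (c : Letter) {h : H} (hh : h ∈ spanStartA) :
    snocMap c h ∈ spanStartA := by
  have : spanStartA ≤ spanStartA.comap (snocMap c) := by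
    refine Submodule.span_le.2 ?_
    rintro _ ⟨v, rfl⟩
    exact Submodule.subset_span ⟨v ++ [c], by simp⟩
  exact this hh

/-- Reversal brings the image of the final `b` to the front, and `β .b = 0` makes it a multiple of
`a`. -/
theorem antiExtend_mem_spanStartA (hf : ∀ c, f c = α c • letter .a + β c • letter .b)
    (hb : β .b = 0) (w : Word) : antiExtend f (word (w ++ [.b])) ∈ spanStartA := by
  induction w with
  | nil =>
    rw [List.nil_append, ← consMap_word, antiExtend_consMap hf, hb]
    simp only [antiExtend_nil, snocMap_word, zero_smul, add_zero]
    exact Submodule.smul_mem _ _ (Submodule.subset_span ⟨[], rfl⟩)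
  | cons c w ih =>
    rw [List.cons_append, ← consMap_word, antiExtend_consMap hf]
    exact Submodule.add_mem _ (Submodule.smul_mem _ _ (snocMap_mem_spanStartA _ ih))
      (Submodule.smul_mem _ _ (snocMap_mem_spanStartA _ ih))

end AntiExtend

/-! ### Generation of the shuffle algebra -/

theorem shuffleWord_singleton_cons (x y : Letter) (v : Word) :
    shuffleWord [x] (y :: v) = word (x :: y :: v) + consMap y (shuffleWord [x] v) := by
  simp [shuffleWord_cons_cons]

theorem shuffleWord_singleton_snoc (x y : Letter) (v : Word) :
    shuffleWord [x] (v ++ [y]) = word (v ++ [y, x]) + snocMap y (shuffleWord [x] v) := by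
  have := shuffleWord_snoc_snoc x y [] v
  simpa using this

theorem shuffleWord_singleton_replicate (x : Letter) (n : ℕ) :
    shuffleWord [x] (List.replicate n x) = (n + 1 : ℚ) • word (List.replicate (n + 1) x) := by
  induction n with
  | zero => simp
  | succ n ih =>
    rw [List.replicate_succ, shuffleWord_singleton_cons, ih]
    simp only [map_smul, consMap_word, ← List.replicate_succ]
    push_cast
    module

/-- The new `x` either joins the initial run, in one of `n + 1` places with the same result, or
lands after `y` and leaves that run at length `n`. Up to division by `n + 1`, a longer run is thus
reduced to shorter ones. -/
theorem shuffleWord_singleton_replicate_append (x y : Letter) (n : ℕ) (v : Word) :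
    ∃ N : H →ₗ[ℚ] H, (∀ w, N (word w) = word (List.replicate n x ++ y :: w)) ∧
    shuffleWord [x] (List.replicate n x ++ y :: v) =
      (n + 1 : ℚ) • word (List.replicate (n + 1) x ++ y :: v) + N (shuffleWord [x] v) := by
  induction n with
  | zero =>
    refine ⟨consMap y, fun w => by simp, ?_⟩
    simp [shuffleWord_singleton_cons]
  | succ n ih =>
    obtain ⟨N, hN, h⟩ := ih
    refine ⟨consMap x ∘ₗ N, fun w => by simp [hN, List.replicate_succ], ?_⟩
    rw [List.replicate_succ, List.cons_append, shuffleWord_singleton_cons, h]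
    simp only [map_add, map_smul, consMap_word, ← List.replicate_succ, ← List.cons_append,
      LinearMap.comp_apply]
    push_cast
    module

theorem shuffleWord_singleton_append_replicate (x y : Letter) (n : ℕ) (v : Word) :
    ∃ N : H →ₗ[ℚ] H, (∀ w, N (word w) = word (w ++ y :: List.replicate n x)) ∧
    shuffleWord [x] (v ++ y :: List.replicate n x) =
      (n + 1 : ℚ) • word (v ++ y :: List.replicate (n + 1) x) + N (shuffleWord [x] v) := by
  induction n with
  | zero =>
    refine ⟨snocMap y, fun w => by simp, ?_⟩
    simp [shuffleWord_singleton_snoc]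
  | succ n ih =>
    obtain ⟨N, hN, h⟩ := ih
    refine ⟨snocMap x ∘ₗ N, fun w => by simp [hN, List.replicate_succ'], ?_⟩
    have e : v ++ y :: List.replicate (n + 1) x = (v ++ y :: List.replicate n x) ++ [x] := by
      simp [List.replicate_succ']
    have e' : v ++ y :: List.replicate (n + 1 + 1) x =
        (v ++ y :: List.replicate n x) ++ [x, x] := by
      simp [List.replicate_succ']
    rw [e, shuffleWord_singleton_snoc, h, ← e', map_add, map_smul, snocMap_word]
    have e'' : v ++ y :: List.replicate (n + 1) x ++ [x] =
        v ++ y :: List.replicate (n + 1 + 1) x := by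
      simp [List.replicate_succ']
    rw [e'', LinearMap.comp_apply]
    push_cast
    module

theorem exists_eq_replicate_or (x : Letter) (w : Word) :
    (∃ n, w = List.replicate n x) ∨
      ∃ n y v, y ≠ x ∧ w = List.replicate n x ++ y :: v := by
  induction w with
  | nil => exact .inl ⟨0, rfl⟩
  | cons c w ih =>
    by_cases hc : c = x
    · subst hc
      rcases ih with ⟨n, rfl⟩ | ⟨n, y, v, hy, rfl⟩
      · exact .inl ⟨n + 1, by simp [List.replicate_succ]⟩
      · exact .inr ⟨n + 1, y, v, hy, by simp [List.replicate_succ]⟩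
    · exact .inr ⟨0, c, w, hc, by simp⟩

theorem mem_of_smul_add {N : Submodule ℚ H} {n : ℕ} {x y z : H} (hz : z ∈ N)
    (h : z = (n + 1 : ℚ) • x + y) (hy : y ∈ N) : x ∈ N := by
  have h1 : (n + 1 : ℚ) • x ∈ N := by
    have : (n + 1 : ℚ) • x = z - y := by rw [h]; abel
    rw [this]
    exact N.sub_mem hz hy
  exact (N.smul_mem_iff (by positivity)).1 h1

theorem replicate_mem {N : Submodule ℚ H} {x : Letter}
    (hx : ∀ h ∈ N, shuffle (letter x) h ∈ N) (h0 : word [] ∈ N) (n : ℕ) :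
    word (List.replicate n x) ∈ N := by
  induction n with
  | zero => exact h0
  | succ n ih =>
    have := hx _ ih
    rw [letter, shuffle_word] at this
    exact mem_of_smul_add this (by rw [shuffleWord_singleton_replicate, add_zero]) (zero_mem _)

theorem mem_of_forall_word {N : Submodule ℚ H} (h : ∀ w, word w ∈ N) (x : H) : x ∈ N := by
  induction x using induction_word with
  | h0 => exact N.zero_mem
  | hw w => exact h w
  | hadd x y hx hy => exact N.add_mem hx hy
  | hsmul q x hx => exact N.smul_mem q hx

/-- Induction on the number of leading `b`s: shuffling with `b` produces one more, up to terms with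
fewer. -/
theorem eq_top_of_shuffle_b {N : Submodule ℚ H} (hb : ∀ h ∈ N, shuffle (letter .b) h ∈ N)
    (h0 : word [] ∈ N) (ha : ∀ v, word (.a :: v) ∈ N) (x : H) : x ∈ N := by
  refine mem_of_forall_word (fun w => ?_) x
  rcases exists_eq_replicate_or .b w with ⟨n, rfl⟩ | ⟨n, y, v, hy, rfl⟩
  · exact replicate_mem hb h0 n
  obtain rfl : y = .a := by cases y <;> simp_all
  clear hy
  induction n generalizing v with
  | zero => exact ha v
  | succ n ih =>
    have h1 := hb _ (ih v)
    rw [letter, shuffle_word] at h1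
    obtain ⟨T, hT, h⟩ := shuffleWord_singleton_replicate_append .b .a n v
    refine mem_of_smul_add h1 h ?_
    exact mem_of_forall_word (N := N.comap T) (fun w => by simpa [hT] using ih w) _

theorem consMap_a_mem_spanStartA (h : H) : consMap .a h ∈ spanStartA :=
  mem_of_forall_word (N := spanStartA.comap (consMap .a))
    (fun w => Submodule.subset_span ⟨w, by simp⟩) h

theorem word_a_cons_mem_of_shuffle_a {N : Submodule ℚ H}
    (ha : ∀ h ∈ N, shuffle (letter .a) h ∈ N) (h0 : word [] ∈ N)
    (hab : ∀ v, word (.a :: v ++ [.b]) ∈ N) (v : Word) : word (.a :: v) ∈ N := by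
  -- Reversing exposes the run of trailing `a`s, on whose length the induction runs.
  rcases exists_eq_replicate_or .a (Letter.a :: v).reverse with ⟨n, hn⟩ | ⟨n, y, u, hy, hu⟩
  · rw [List.reverse_eq_iff, List.reverse_replicate] at hn
    rw [hn]
    exact replicate_mem ha h0 n
  obtain rfl : y = .b := by cases y <;> simp_all
  rw [List.reverse_eq_iff] at hu
  simp only [List.reverse_append, List.reverse_cons, List.reverse_replicate, List.append_assoc,
    List.cons_append, List.nil_append] at hu
  obtain ⟨t, ht⟩ : ∃ t, u.reverse = .a :: t := by
    rcases h : u.reverse with _ | ⟨c, t⟩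
    · simp [h] at hu
    · rw [h] at hu
      simp only [List.cons_append, List.cons.injEq] at hu
      exact ⟨t, by rw [hu.1]⟩
  rw [hu, ht]
  clear hu ht hy
  induction n generalizing t with
  | zero => exact hab t
  | succ n ih =>
    have h1 := ha _ (ih t)
    rw [letter, shuffle_word] at h1
    obtain ⟨T, hT, h⟩ := shuffleWord_singleton_append_replicate .a .b n (.a :: t)
    refine mem_of_smul_add h1 h ?_
    -- The induction hypothesis covers only words that start with `a`. That suffices, since
    -- shuffling `a` into such a word yields only words of this kind.
    have h2 : spanStartA ≤ N.comap T := by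
      refine Submodule.span_le.2 ?_
      rintro _ ⟨w, rfl⟩
      simpa [hT] using ih w
    refine h2 ?_
    rw [shuffleWord_singleton_cons]
    exact Submodule.add_mem _ (Submodule.subset_span ⟨_, rfl⟩) (consMap_a_mem_spanStartA _)

/-- Two shuffle morphisms that agree on `b` and on all words that start with `a` are equal. -/
theorem IsShuffleMorphism.ext_startA {A : Type*} [CommRing A] [Algebra ℚ A] {F G : H →ₗ[ℚ] A}
    (hF : IsShuffleMorphism F) (hG : IsShuffleMorphism G)
    (hb : F (letter .b) = G (letter .b)) (ha : ∀ v, F (word (.a :: v)) = G (word (.a :: v))) :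
    F = G := by
  refine LinearMap.ext fun x => ?_
  refine eq_top_of_shuffle_b (N := LinearMap.eqLocus F G) (fun h hh => ?_) ?_ ha x
  · rw [LinearMap.mem_eqLocus] at hh ⊢
    rw [hF.2, hG.2, hb, hh]
  · rw [LinearMap.mem_eqLocus, hF.1, hG.1]

/-- Two shuffle morphisms that agree on `a`, on `b` and on all words that start with `a` and end
with `b` are equal. -/
theorem IsShuffleMorphism.ext_startA_endB {A : Type*} [CommRing A] [Algebra ℚ A]
    {F G : H →ₗ[ℚ] A} (hF : IsShuffleMorphism F) (hG : IsShuffleMorphism G)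
    (ha : F (letter .a) = G (letter .a)) (hb : F (letter .b) = G (letter .b))
    (hab : ∀ v, F (word (.a :: v ++ [.b])) = G (word (.a :: v ++ [.b]))) : F = G := by
  refine hF.ext_startA hG hb fun v => ?_
  refine word_a_cons_mem_of_shuffle_a (N := LinearMap.eqLocus F G) (fun h hh => ?_) ?_ hab v
  · rw [LinearMap.mem_eqLocus] at hh ⊢
    rw [hF.2, hG.2, ha, hh]
  · rw [LinearMap.mem_eqLocus, hF.1, hG.1]

/-! ### Words and sequences of exponents -/

/-- This mirrors the growth of a word from `a` by letters at the end: a new last exponent 1 is an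
appended `a`, and raising the last exponent is an appended `b`. -/
theorem seq_induction {P : ∀ k : ℕ, (Fin (k + 1) → ℕ+) → Prop} (one : P 0 fun _ => 1)
    (snoc : ∀ k r, P k r → P (k + 1) (Fin.snoc r 1))
    (incr : ∀ k r, P k r → P k (Function.update r (Fin.last k) (r (Fin.last k) + 1)))
    (k : ℕ) (r : Fin (k + 1) → ℕ+) : P k r := by
  have step : ∀ k (r : Fin (k + 1) → ℕ+), P k (Function.update r (Fin.last k) 1) →
      ∀ m : ℕ+, P k (Function.update r (Fin.last k) m) := by
    intro k r h m
    induction m using PNat.recOn with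
    | one => exact h
    | succ m ih => simpa using incr k _ ih
  induction k with
  | zero =>
    have := step 0 r (by
      convert one using 1
      ext i
      fin_cases i
      simp) (r (Fin.last 0))
    simpa using this
  | succ k ih =>
    have := step (k + 1) r (by
      convert snoc k _ (ih (Fin.init r)) using 1
      conv_lhs => rw [← Fin.snoc_init_self r]
      rw [Fin.update_snoc_last]) (r (Fin.last _))
    simpa using this

theorem seqWord_one : seqWord (k := 0) (fun _ => 1) = [.a] := by
  simp [seqWord]

theorem seqWord_snoc {k : ℕ} (r : Fin (k + 1) → ℕ+) :
    seqWord (Fin.snoc r 1 : Fin (k + 2) → ℕ+) = seqWord r ++ [.a] := by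
  rw [seqWord, List.ofFn_succ_last]
  simp [seqWord]

theorem seqWord_incr {k : ℕ} (r : Fin (k + 1) → ℕ+) :
    seqWord (Function.update r (Fin.last k) (r (Fin.last k) + 1)) = seqWord r ++ [.b] := by
  rw [seqWord, seqWord, List.ofFn_succ_last, List.ofFn_succ_last]
  obtain ⟨m, hm⟩ : ∃ m : ℕ, (r (Fin.last k) : ℕ) = m + 1 :=
    ⟨_, (Nat.succ_pred_eq_of_pos (r (Fin.last k)).pos).symm⟩
  simp [hm, List.replicate_succ']

theorem exists_seqWord_eq_cons {k : ℕ} (r : Fin (k + 1) → ℕ+) : ∃ v, seqWord r = .a :: v := by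
  induction k, r using seq_induction with
  | one => exact ⟨[], seqWord_one⟩
  | snoc k r ih =>
    obtain ⟨v, hv⟩ := ih
    exact ⟨v ++ [.a], by rw [seqWord_snoc, hv, List.cons_append]⟩
  | incr k r ih =>
    obtain ⟨v, hv⟩ := ih
    exact ⟨v ++ [.b], by rw [seqWord_incr, hv, List.cons_append]⟩

theorem exists_eq_seqWord (v : Word) : ∃ (k : ℕ) (r : Fin (k + 1) → ℕ+), .a :: v = seqWord r := by
  induction v using List.reverseRecOn with
  | nil => exact ⟨0, fun _ => 1, seqWord_one.symm⟩
  | append_singleton v c ih =>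
    obtain ⟨k, r, hr⟩ := ih
    rw [← List.cons_append, hr]
    cases c
    · exact ⟨k + 1, _, (seqWord_snoc r).symm⟩
    · exact ⟨k, _, (seqWord_incr r).symm⟩

theorem exists_incr_eq {k : ℕ} (r : Fin (k + 1) → ℕ+) (hr : 2 ≤ r (Fin.last k)) :
    ∃ r' : Fin (k + 1) → ℕ+, r = Function.update r' (Fin.last k) (r' (Fin.last k) + 1) := by
  refine ⟨Function.update r (Fin.last k) (r (Fin.last k) - 1), ?_⟩
  have h : r (Fin.last k) - 1 + 1 = r (Fin.last k) :=
    PNat.sub_add_of_lt (lt_of_lt_of_le (by decide) hr)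
  simp [h]

open Metric

/-! ### Families of linear functionals that solve a differential equation -/

/-- The differential equations have the coefficient `1/z`, so they say nothing at 0; continuity of
the derivative of a holomorphic function fills the gap. -/
theorem eq_of_deriv_eq_zero_of_ne {U : Set ℂ} (hU : IsOpen U) (hc : Convex ℝ U)
    (h0 : (0 : ℂ) ∈ U) {f : ℂ → ℂ} (hf : DifferentiableOn ℂ f U)
    (hd : ∀ z ∈ U, z ≠ 0 → deriv f z = 0) {z : ℂ} (hz : z ∈ U) : f z = f 0 := by
  have hd0 : deriv f 0 = 0 := by
    have h1 : ContinuousAt (deriv f) 0 :=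
      ((hf.deriv hU).continuousOn).continuousAt (hU.mem_nhds h0)
    have h2 : Filter.Tendsto (deriv f) (𝓝[≠] 0) (𝓝 0) := by
      refine tendsto_const_nhds.congr' ?_
      filter_upwards [self_mem_nhdsWithin, nhdsWithin_le_nhds (hU.mem_nhds h0)] with x hx hx'
      exact (hd x hx' hx).symm
    exact tendsto_nhds_unique (h1.tendsto.mono_left nhdsWithin_le_nhds) h2
  refine hU.is_const_of_deriv_eq_zero hc.isPreconnected hf (fun x hx => ?_) hz h0
  by_cases hx0 : x = 0
  · simp [hx0, hd0]
  · exact hd x hx hx0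

theorem hasDerivAt_of_word {χ : ℂ → H →ₗ[ℚ] ℂ} {χ' : H →ₗ[ℚ] ℂ} {z : ℂ}
    (hχ : ∀ w, HasDerivAt (fun z => χ z (word w)) (χ' (word w)) z) (h : H) :
    HasDerivAt (fun z => χ z h) (χ' h) z := by
  induction h using induction_word with
  | h0 => simpa using hasDerivAt_const z (0 : ℂ)
  | hw w => exact hχ w
  | hadd x y hx hy => simpa only [map_add] using hx.fun_add hy
  | hsmul q x hx => simpa only [map_smul] using hx.fun_const_smul q

theorem differentiableOn_of_word {χ : ℂ → H →ₗ[ℚ] ℂ} {U : Set ℂ}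
    (hχ : ∀ w, DifferentiableOn ℂ (fun z => χ z (word w)) U) (h : H) :
    DifferentiableOn ℂ (fun z => χ z h) U := by
  induction h using induction_word with
  | h0 => simp
  | hw w => exact hχ w
  | hadd x y hx hy => simpa only [map_add] using hx.fun_add hy
  | hsmul q x hx => simpa only [map_smul] using hx.fun_const_smul q

/-- By the Leibniz rule, the derivative of the defect `χ(u)χ(v) - χ(u * v)` is a combination of
defects of smaller total length, which vanish by induction. The defect is therefore constant, and
the initial condition makes it 0. -/
theorem isShuffleMorphism_of_hasDerivAt {U : Set ℂ} (hU : IsOpen U) (hc : Convex ℝ U)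
    (h0 : (0 : ℂ) ∈ U) {κ : Type*} [Fintype κ] {D : κ → H →ₗ[ℚ] H}
    (hD : ∀ k, IsShuffleDerivation (D k)) (hl : ∀ k, LowersLength (D k)) {α : κ → ℂ → ℂ}
    {χ : ℂ → H →ₗ[ℚ] ℂ} (hdiff : ∀ w, DifferentiableOn ℂ (fun z => χ z (word w)) U)
    (hχ : ∀ w, ∀ z ∈ U, z ≠ 0 →
      HasDerivAt (fun z => χ z (word w)) (∑ k, α k z * χ z (D k (word w))) z)
    (hinit : ∀ w, χ 0 (word w) = if w = [] then 1 else 0) {z : ℂ} (hz : z ∈ U) :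
    IsShuffleMorphism (χ z) := by
  have hderiv : ∀ h : H, ∀ z ∈ U, z ≠ 0 →
      HasDerivAt (fun z => χ z h) (∑ k, α k z * χ z (D k h)) z := by
    intro h z hz hz0
    have := hasDerivAt_of_word (χ := χ) (χ' := ∑ k, α k z • (χ z ∘ₗ D k)) (z := z)
      (fun w => by simpa using hχ w z hz hz0) h
    simpa using this
  have hmul : ∀ n : ℕ, ∀ u v : Word, u.length + v.length = n → ∀ z ∈ U,
      χ z (word u) * χ z (word v) - χ z (shuffleWord u v) = 0 := by
    intro n
    induction n using Nat.strong_induction_on with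
    | _ n ih =>
    intro u v huv z hz
    have key : (fun z => χ z (word u) * χ z (word v) - χ z (shuffleWord u v)) z =
        (fun z => χ z (word u) * χ z (word v) - χ z (shuffleWord u v)) 0 := by
      refine eq_of_deriv_eq_zero_of_ne hU hc h0
        (((hdiff u).mul (hdiff v)).sub (differentiableOn_of_word hdiff _)) ?_ hz
      intro z hz hz0
      have hu : ∀ k, χ z (shuffle (D k (word u)) (word v)) =
          χ z (D k (word u)) * χ z (word v) := by
        intro k
        have : Submodule.span ℚ (word '' {w | w.length < u.length}) ≤
            LinearMap.eqLocus (χ z ∘ₗ shuffle.flip (word v))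
              (LinearMap.mulRight ℚ (χ z (word v)) ∘ₗ χ z) := by
          refine Submodule.span_le.2 ?_
          rintro _ ⟨w, hw, rfl⟩
          have h1 : w.length < u.length := hw
          have := ih (w.length + v.length) (by omega) w v rfl z hz
          simpa using (sub_eq_zero.1 this).symm
        simpa using this (hl k u)
      have hv : ∀ k, χ z (shuffle (word u) (D k (word v))) =
          χ z (word u) * χ z (D k (word v)) := by
        intro k
        have : Submodule.span ℚ (word '' {w | w.length < v.length}) ≤
            LinearMap.eqLocus (χ z ∘ₗ shuffle (word u))
              (LinearMap.mulLeft ℚ (χ z (word u)) ∘ₗ χ z) := by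
          refine Submodule.span_le.2 ?_
          rintro _ ⟨w, hw, rfl⟩
          have h1 : w.length < v.length := hw
          have := ih (u.length + w.length) (by omega) u w rfl z hz
          simpa using (sub_eq_zero.1 this).symm
        simpa using this (hl k v)
      have := ((hχ u z hz hz0).mul (hχ v z hz hz0)).sub (hderiv (shuffleWord u v) z hz hz0)
      refine this.deriv.trans ?_
      simp only [hD _ u v, map_add, hu, hv, Finset.sum_mul, Finset.mul_sum, mul_add,
        ← Finset.sum_add_distrib, ← Finset.sum_sub_distrib]
      exact Finset.sum_eq_zero fun k _ => by ring
    refine key.trans ?_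
    rcases u with _ | ⟨x, u⟩
    · simp [hinit]
    rcases v with _ | ⟨y, v⟩
    · simp [hinit]
    have hcons : ∀ x h, χ 0 (consMap x h) = 0 := by
      intro x h
      have : χ 0 ∘ₗ consMap x = 0 := hom_ext_word fun w => by simp [hinit]
      exact LinearMap.congr_fun this h
    simp [hinit, shuffleWord_cons_cons, hcons]
  refine .of_word ?_ fun u v => (sub_eq_zero.1 (hmul _ u v rfl z hz)).symm
  have : (fun z => χ z (word [])) z = (fun z => χ z (word [])) 0 := by
    refine eq_of_deriv_eq_zero_of_ne hU hc h0 (hdiff []) (fun z hz hz0 => ?_) hz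
    rw [(hχ [] z hz hz0).deriv]
    have : ∀ k, D k (word []) = 0 := fun k => by simpa using hl k []
    simp [this]
  simpa [hinit] using this

/-! ### The exponential functional -/

/-- The functional `b ⋯ b ↦ ℓⁿ / n!`, which vanishes on all words that contain `a`. -/
def expChar (l : ℂ) : H →ₗ[ℚ] ℂ :=
  Finsupp.linearCombination ℚ fun w =>
    if Letter.a ∈ w then 0 else l ^ w.length / (w.length.factorial : ℂ)

theorem expChar_word (l : ℂ) (w : Word) : expChar l (word w) =
    if Letter.a ∈ w then 0 else l ^ w.length / (w.length.factorial : ℂ) := by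
  simp [expChar]

theorem hasDerivAt_expChar (w : Word) (l : ℂ) :
    HasDerivAt (fun l => expChar l (word w)) (expChar l (deleteLast .b (word w))) l := by
  rcases List.eq_nil_or_concat w with rfl | ⟨w, c, rfl⟩
  · simpa [expChar_word] using hasDerivAt_const l (1 : ℂ)
  rw [List.concat_eq_append, deleteLast_snoc]
  cases c
  · simpa [expChar_word] using hasDerivAt_const l (0 : ℂ)
  · by_cases ha : Letter.a ∈ w
    · simpa [expChar_word, ha] using hasDerivAt_const l (0 : ℂ)
    · simp only [expChar_word, if_true]
      simp only [List.mem_append, ha, List.mem_singleton, reduceCtorEq, or_self, if_false,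
        List.length_append, List.length_singleton]
      refine ((hasDerivAt_pow (w.length + 1) l).div_const _).congr_deriv ?_
      rw [Nat.factorial_succ]
      have h1 : (w.length.factorial : ℂ) ≠ 0 := by exact_mod_cast w.length.factorial_ne_zero
      have h2 : (w.length + 1 : ℂ) ≠ 0 := by exact_mod_cast w.length.succ_ne_zero
      push_cast
      field_simp

theorem isShuffleMorphism_expChar (l : ℂ) : IsShuffleMorphism (expChar l) := by
  refine isShuffleMorphism_of_hasDerivAt (χ := expChar) (κ := Unit) (D := fun _ => deleteLast .b)
    (α := fun _ _ => 1) isOpen_univ convex_univ (Set.mem_univ 0)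
    (fun _ => isShuffleDerivation_deleteLast _) (fun _ => lowersLength_deleteLast _)
    (fun w z _ => (hasDerivAt_expChar w z).differentiableAt.differentiableWithinAt)
    (fun w z _ _ => by simpa using hasDerivAt_expChar w z) ?_ (Set.mem_univ l)
  rintro (_ | ⟨c, w⟩)
  · simp [expChar_word]
  · simp [expChar_word]

/-! ### The functional that is holomorphic on the whole disc -/

/-- The primitive on the unit disc that vanishes at `0`. -/
def discPrimitive (g : ℂ → ℂ) : ℂ → ℂ :=
  Classical.epsilon fun F => F 0 = 0 ∧ ∀ z ∈ ball (0 : ℂ) 1, HasDerivAt F (g z) z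

theorem discPrimitive_spec {g : ℂ → ℂ} (hg : DifferentiableOn ℂ g (ball 0 1)) :
    discPrimitive g 0 = 0 ∧ ∀ z ∈ ball (0 : ℂ) 1, HasDerivAt (discPrimitive g) (g z) z :=
  Classical.epsilon_spec (hg.isExactOn_ball.with_val_at 0 0)

/-- The coefficients of the solution of `M' = M (a ω_a + b ω_b) - b ω_b M` with value `1` at
`0`, where `ω_a = 1 / (1 - z)` and `ω_b = 1 / z`. -/
def discWord : Word → ℂ → ℂ
  | [] => fun _ => 1
  | x :: u => discPrimitive fun z =>
      (if (x :: u).getLast? = some .a then discWord (x :: u).dropLast z / (1 - z) else 0) +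
      dslope (fun z => (if (x :: u).getLast? = some .b then discWord (x :: u).dropLast z else 0) -
        if x = .b then discWord u z else 0) 0 z
termination_by w => w.length
decreasing_by all_goals simp

theorem one_sub_ne_zero_of_mem_ball {z : ℂ} (hz : z ∈ ball (0 : ℂ) 1) : 1 - z ≠ 0 := by
  intro h
  rw [sub_eq_zero] at h
  simp [← h] at hz

theorem discWord_spec (w : Word) : DifferentiableOn ℂ (discWord w) (ball 0 1) ∧
    (discWord w 0 = if w = [] then 1 else 0) ∧
    ∀ z ∈ ball (0 : ℂ) 1, z ≠ 0 → HasDerivAt (discWord w)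
      ((if w.getLast? = some .a then discWord w.dropLast z / (1 - z) else 0) +
      ((if w.getLast? = some .b then discWord w.dropLast z else 0) -
        if w.head? = some .b then discWord w.tail z else 0) / z) z := by
  match w with
  | [] =>
    refine ⟨?_, ?_, fun z _ _ => ?_⟩
    · rw [discWord]; exact differentiableOn_const 1
    · rw [discWord]; simp
    · rw [discWord]; simpa using hasDerivAt_const z (1 : ℂ)
  | x :: u =>
    obtain ⟨h1, h2, -⟩ := discWord_spec (x :: u).dropLast
    obtain ⟨h3, h4, -⟩ := discWord_spec u
    set N : ℂ → ℂ := fun z =>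
      (if (x :: u).getLast? = some .b then discWord (x :: u).dropLast z else 0) -
        if x = .b then discWord u z else 0 with hN
    have hNd : DifferentiableOn ℂ N (ball 0 1) := by
      refine DifferentiableOn.sub ?_ ?_
      · split_ifs
        · exact h1
        · exact differentiableOn_const 0
      · split_ifs
        · exact h3
        · exact differentiableOn_const 0
    -- This makes `N z / z` extend holomorphically over 0 as `dslope N 0`. For the word `b` the two
    -- terms both equal 1 and cancel; for every other word each term already vanishes at 0.
    have hN0 : N 0 = 0 := by
      simp only [hN, h2, h4]
      rcases u with _ | ⟨y, u⟩
      · cases x <;> simp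
      · simp
    have hM : discWord (x :: u) = discPrimitive fun z =>
        (if (x :: u).getLast? = some .a then discWord (x :: u).dropLast z / (1 - z) else 0) +
          dslope N 0 z := by rw [discWord]
    obtain ⟨h5, h6⟩ := discPrimitive_spec (g := fun z =>
        (if (x :: u).getLast? = some .a then discWord (x :: u).dropLast z / (1 - z) else 0) +
          dslope N 0 z) (by
        refine DifferentiableOn.add ?_ ?_
        · split_ifs
          · exact h1.div ((differentiableOn_const 1).sub differentiableOn_id)
              fun z hz => one_sub_ne_zero_of_mem_ball hz
          · exact differentiableOn_const 0
        · exact (Complex.differentiableOn_dslope (ball_mem_nhds _ one_pos)).2 hNd)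
    rw [← hM] at h5 h6
    refine ⟨fun z hz => (h6 z hz).differentiableAt.differentiableWithinAt, by simp [h5],
      fun z hz hz0 => (h6 z hz).congr_deriv ?_⟩
    rw [dslope_of_ne _ hz0, slope_def_field, hN0, sub_zero, sub_zero]
    simp [hN]
termination_by w.length
decreasing_by all_goals simp

/-- The functional `h ↦ M_h(z)`. -/
def discChar (z : ℂ) : H →ₗ[ℚ] ℂ := Finsupp.linearCombination ℚ fun w => discWord w z

@[simp]
theorem discChar_word (z : ℂ) (w : Word) : discChar z (word w) = discWord w z := by
  simp [discChar]

theorem hasDerivAt_discChar {z : ℂ} (hz : z ∈ ball (0 : ℂ) 1) (hz0 : z ≠ 0) (h : H) :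
    HasDerivAt (fun z => discChar z h) (((1 - z)⁻¹ • discChar z ∘ₗ deleteLast .a +
      z⁻¹ • discChar z ∘ₗ (deleteLast .b - deleteHead .b)) h) z := by
  refine hasDerivAt_of_word (fun w => ?_) h
  simp only [discChar_word]
  refine ((discWord_spec w).2.2 z hz hz0).congr_deriv ?_
  simp only [deleteLast, deleteHead, LinearMap.add_apply, LinearMap.smul_apply,
    LinearMap.comp_apply, LinearMap.sub_apply, linearCombination_word, map_sub, smul_eq_mul]
  split_ifs <;> simp <;> ring

theorem isShuffleMorphism_discChar {z : ℂ} (hz : z ∈ ball (0 : ℂ) 1) :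
    IsShuffleMorphism (discChar z) := by
  refine isShuffleMorphism_of_hasDerivAt (χ := discChar) (κ := Bool)
    (D := fun k => if k then deleteLast .a else deleteLast .b - deleteHead .b)
    (α := fun k z => if k then (1 - z)⁻¹ else z⁻¹) isOpen_ball (convex_ball _ _)
    (mem_ball_self one_pos) ?_ ?_ (fun w => by simpa using (discWord_spec w).1)
    (fun w z hz hz0 => by simpa using hasDerivAt_discChar hz hz0 (word w))
    (fun w => by simpa using (discWord_spec w).2.1) hz
  · rintro (_ | _)
    · exact (isShuffleDerivation_deleteLast _).sub (isShuffleDerivation_deleteHead _)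
    · exact isShuffleDerivation_deleteLast _
  · rintro (_ | _)
    · exact (lowersLength_deleteLast _).sub (lowersLength_deleteHead _)
    · exact lowersLength_deleteLast _

/-! ### The polylogarithm functional -/

/-- The functional `h ↦ L_h(z)`. -/
def polylogChar (z : ℂ) : H →ₗ[ℚ] ℂ := conv (expChar (Complex.log z)) (discChar z)

theorem mem_ball_of_mem_Omega {z : ℂ} (hz : z ∈ Omega) : z ∈ ball (0 : ℂ) 1 := hz.1

theorem ne_zero_of_mem_Omega {z : ℂ} (hz : z ∈ Omega) : z ≠ 0 := Complex.slitPlane_ne_zero hz.2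

theorem isShuffleMorphism_polylogChar {z : ℂ} (hz : z ∈ Omega) :
    IsShuffleMorphism (polylogChar z) :=
  (isShuffleMorphism_expChar _).conv (isShuffleMorphism_discChar (mem_ball_of_mem_Omega hz))

theorem hasDerivAt_conv {F G : ℂ → H →ₗ[ℚ] ℂ} {F' G' : H →ₗ[ℚ] ℂ} {z : ℂ}
    (hF : ∀ h, HasDerivAt (fun z => F z h) (F' h) z)
    (hG : ∀ h, HasDerivAt (fun z => G z h) (G' h) z) (h : H) :
    HasDerivAt (fun z => conv (F z) (G z) h) ((conv F' (G z) + conv (F z) G') h) z := by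
  refine hasDerivAt_of_word (fun w => ?_) h
  simp only [conv_word_eq_sum, LinearMap.add_apply, ← Finset.sum_add_distrib]
  exact HasDerivAt.fun_sum fun i _ => (hF _).mul (hG _)

/-- Differentiating `exp(b log z)` produces a `b` between the two factors. It cancels against the
term `-b ω_b M` in the equation for `M`, which leaves only deletions of the last letter. -/
theorem hasDerivAt_polylogChar {z : ℂ} (hz : z ∈ Omega) (h : H) :
    HasDerivAt (fun z => polylogChar z h) (((1 - z)⁻¹ • polylogChar z ∘ₗ deleteLast .a +
      z⁻¹ • polylogChar z ∘ₗ deleteLast .b) h) z := by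
  have hE : ∀ h, HasDerivAt (fun z => expChar (Complex.log z) h)
      ((z⁻¹ • expChar (Complex.log z) ∘ₗ deleteLast .b) h) z := by
    refine hasDerivAt_of_word (χ := fun z => expChar (Complex.log z)) fun w => ?_
    refine ((hasDerivAt_expChar w (Complex.log z)).comp z
      (Complex.hasDerivAt_log hz.2)).congr_deriv ?_
    simp [mul_comm]
  refine (hasDerivAt_conv hE
    (hasDerivAt_discChar (mem_ball_of_mem_Omega hz) (ne_zero_of_mem_Omega hz)) h).congr_deriv ?_
  have : conv (expChar (Complex.log z)) (discChar z ∘ₗ (deleteLast .b - deleteHead .b)) =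
      polylogChar z ∘ₗ deleteLast .b -
        conv (expChar (Complex.log z)) (discChar z ∘ₗ deleteHead .b) := by
    rw [eq_sub_iff_add_eq, ← conv_add_right, polylogChar, ← conv_deleteLast_right]
    congr 1
    rw [LinearMap.comp_sub, sub_add_cancel]
  rw [conv_add_right, conv_smul_left, conv_smul_right, conv_smul_right, conv_deleteLast_left,
    conv_deleteLast_right, this]
  simp only [polylogChar, LinearMap.add_apply, LinearMap.smul_apply, LinearMap.sub_apply,
    smul_eq_mul]
  ring

/-- Every non-empty prefix contains `a` and is killed by the exponential factor, so no logarithm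
appears. -/
theorem polylogChar_a_cons (z : ℂ) (v : Word) :
    polylogChar z (word (.a :: v)) = discWord (.a :: v) z := by
  rw [polylogChar, conv_word, splitSum, splitSum_eq_sum]
  simp [expChar_word]

theorem discWord_b {z : ℂ} (hz : z ∈ ball (0 : ℂ) 1) : discWord [.b] z = 0 := by
  obtain ⟨h1, h2, h3⟩ := discWord_spec [.b]
  rw [eq_of_deriv_eq_zero_of_ne isOpen_ball (convex_ball _ _) (mem_ball_self one_pos) h1
    (fun z hz hz0 => ?_) hz, h2]
  · simp
  · simpa using (h3 z hz hz0).deriv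

theorem polylogChar_b {z : ℂ} (hz : z ∈ Omega) : polylogChar z (letter .b) = Complex.log z := by
  have h1 : discWord [] z = 1 := by rw [discWord]
  simp [polylogChar, letter, conv_word, splitSum, expChar_word,
    discWord_b (mem_ball_of_mem_Omega hz), h1]

theorem discWord_a {z : ℂ} (hz : z ∈ ball (0 : ℂ) 1) :
    discWord [.a] z = -Complex.log (1 - z) := by
  obtain ⟨h1, h2, h3⟩ := discWord_spec [.a]
  have hs : ∀ z ∈ ball (0 : ℂ) 1, 1 - z ∈ Complex.slitPlane := fun z hz => by
    simpa [sub_eq_add_neg] using Complex.mem_slitPlane_of_norm_lt_one (z := -z) (by simpa using hz)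
  have hl : ∀ z ∈ ball (0 : ℂ) 1,
      HasDerivAt (fun z => Complex.log (1 - z)) (-1 / (1 - z)) z := fun z hz =>
    ((hasDerivAt_id z).const_sub 1).clog (hs z hz)
  have h4 : ∀ z, discWord [] z = 1 := fun z => by rw [discWord]
  have := eq_of_deriv_eq_zero_of_ne (f := fun z => discWord [.a] z + Complex.log (1 - z))
    isOpen_ball (convex_ball _ _) (mem_ball_self one_pos)
    (h1.add fun z hz => (hl z hz).differentiableAt.differentiableWithinAt)
    (fun z hz hz0 => by
      rw [((h3 z hz hz0).fun_add (hl z hz)).deriv]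
      simp [h4]
      ring) hz
  simp only [h2, sub_zero, Complex.log_one] at this
  exact eq_neg_of_add_eq_zero_left (by simpa using this)

/-! ### The index sets -/

theorem Indices.pos {k : ℕ} (n : Indices k) (i : Fin (k + 1)) : 0 < n.1 i :=
  n.2.1.trans_le (n.2.2.monotone (Fin.zero_le i))

/-- A strictly increasing sequence is given by its initial part and the last increment. -/
def indicesSuccEquiv (k : ℕ) : Indices k × ℕ ≃ Indices (k + 1) where
  toFun p := ⟨Fin.snoc p.1.1 (p.1.1 (Fin.last k) + 1 + p.2), by
    constructor
    · have : (0 : Fin (k + 2)) = Fin.castSucc 0 := rfl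
      rw [this, Fin.snoc_castSucc]
      exact p.1.2.1
    · rw [Fin.strictMono_iff_lt_succ]
      intro i
      rw [Fin.snoc_castSucc]
      induction i using Fin.lastCases with
      | last => rw [Fin.succ_last, Fin.snoc_last]; omega
      | cast i =>
        rw [Fin.succ_castSucc, Fin.snoc_castSucc]
        exact p.1.2.2 (Fin.castSucc_lt_succ)⟩
  invFun n := ⟨⟨Fin.init n.1, n.2.1, n.2.2.comp Fin.strictMono_castSucc⟩,
    n.1 (Fin.last _) - n.1 (Fin.castSucc (Fin.last k)) - 1⟩
  left_inv p := by
    refine Prod.ext (Subtype.ext ?_) ?_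
    · simp
    · simp; omega
  right_inv n := by
    refine Subtype.ext ?_
    have h : n.1 (Fin.castSucc (Fin.last k)) < n.1 (Fin.last _) :=
      n.2.2 (Fin.castSucc_lt_last _)
    have h' : Fin.init n.1 (Fin.last k) + 1 +
        (n.1 (Fin.last _) - n.1 (Fin.castSucc (Fin.last k)) - 1) = n.1 (Fin.last _) := by
      simp only [Fin.init]
      omega
    simp only [h', Fin.snoc_init_self]

/-- Sequences of length one. -/
def indicesZeroEquiv : ℕ ≃ Indices 0 where
  toFun m := ⟨fun _ => m + 1, by simp, fun i j h => by omega⟩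
  invFun n := n.1 0 - 1
  left_inv m := by simp
  right_inv n := by
    refine Subtype.ext (funext fun i => ?_)
    have := n.2.1
    obtain rfl : i = 0 := by omega
    simp only
    omega

@[simp]
theorem indicesZeroEquiv_apply (m : ℕ) (i : Fin 1) : (indicesZeroEquiv m).1 i = m + 1 := rfl

@[simp]
theorem indicesSuccEquiv_last {k : ℕ} (p : Indices k × ℕ) :
    (indicesSuccEquiv k p).1 (Fin.last (k + 1)) = p.1.1 (Fin.last k) + 1 + p.2 :=
  Fin.snoc_last (α := fun _ => ℕ) _ _

@[simp]
theorem indicesSuccEquiv_castSucc {k : ℕ} (p : Indices k × ℕ) (i : Fin (k + 1)) :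
    (indicesSuccEquiv k p).1 i.castSucc = p.1.1 i :=
  Fin.snoc_castSucc (α := fun _ => ℕ) _ _ _

theorem summable_pow_last {t : ℝ} (h0 : 0 ≤ t) (h1 : t < 1) (k : ℕ) :
    Summable fun n : Indices k => t ^ n.1 (Fin.last k) := by
  have hg : Summable fun m : ℕ => t ^ (m + 1) :=
    (summable_nat_add_iff 1).2 (summable_geometric_of_lt_one h0 h1)
  induction k with
  | zero =>
    rw [← indicesZeroEquiv.summable_iff]
    exact hg
  | succ k ih =>
    rw [← (indicesSuccEquiv k).summable_iff]
    refine (ih.mul_of_nonneg hg (fun _ => by positivity) fun _ => by positivity).congr ?_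
    intro p
    simp only [Function.comp_apply, indicesSuccEquiv_last, ← pow_add]
    congr 1
    omega

theorem summable_prod_rpow {e : ℝ} (he : 0 < e) (k : ℕ) :
    Summable fun n : Indices k => ∏ i, ((n.1 i : ℝ) ^ (1 + e))⁻¹ := by
  have hg : Summable fun m : ℕ => ((m : ℝ) ^ (1 + e))⁻¹ :=
    Real.summable_nat_rpow_inv.2 (by linarith)
  induction k with
  | zero =>
    rw [← indicesZeroEquiv.summable_iff]
    refine ((summable_nat_add_iff 1).2 hg).congr fun m => ?_
    simp
  | succ k ih =>
    have h := ih.mul_of_nonneg hg (fun _ => Finset.prod_nonneg fun _ _ => by positivity)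
      fun _ => by positivity
    -- Recording the last index itself instead of its increment embeds the index set in a full
    -- product, where the sum factors.
    have hinj : Function.Injective fun p : Indices k × ℕ =>
        ((p.1, p.1.1 (Fin.last k) + 1 + p.2) : Indices k × ℕ) := by
      rintro ⟨n, m⟩ ⟨n', m'⟩ hp
      simp only [Prod.mk.injEq] at hp
      obtain ⟨rfl, hp⟩ := hp
      exact Prod.ext rfl (by simpa using hp)
    rw [← (indicesSuccEquiv k).summable_iff]
    refine (h.comp_injective hinj).congr fun p => ?_
    rw [Function.comp_apply, Function.comp_apply, Fin.prod_univ_castSucc (n := k + 1)]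
    simp only [indicesSuccEquiv_last, indicesSuccEquiv_castSucc]

/-- The last exponent leaves a spare factor equal to the largest index. Shared equally, it dominates
`n_i^{1/(k+1)}` for each of the `k + 1` indices, so every exponent becomes larger than 1. -/
theorem summable_polyzeta {k : ℕ} (r : Fin (k + 1) → ℕ+) (hr : 2 ≤ r (Fin.last k)) :
    Summable fun n : Indices k => ∏ i, ((n.1 i : ℝ) ^ (r i : ℕ))⁻¹ := by
  have he : (0 : ℝ) < 1 / (k + 1) := by positivity
  refine (summable_prod_rpow he k).of_nonneg_of_le
    (fun n => Finset.prod_nonneg fun _ _ => by positivity) fun n => ?_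
  have hpos : ∀ i, (0 : ℝ) < n.1 i := fun i => by exact_mod_cast n.pos i
  have h1 : ∀ i, (1 : ℝ) ≤ n.1 i := fun i => by exact_mod_cast n.pos i
  rw [Finset.prod_inv_distrib, Finset.prod_inv_distrib]
  refine inv_anti₀ (Finset.prod_pos fun i _ => Real.rpow_pos_of_pos (hpos i) _) ?_
  have h2 : ∏ i, (n.1 i : ℝ) ^ (1 / (k + 1) : ℝ) ≤ n.1 (Fin.last k) := by
    calc ∏ i, (n.1 i : ℝ) ^ (1 / (k + 1) : ℝ)
        ≤ ∏ i : Fin (k + 1), (n.1 (Fin.last k) : ℝ) ^ (1 / (k + 1) : ℝ) := by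
          refine Finset.prod_le_prod (fun i _ => by positivity) fun i _ => ?_
          refine Real.rpow_le_rpow (hpos i).le ?_ he.le
          exact_mod_cast n.2.2.monotone (Fin.le_last i)
      _ = n.1 (Fin.last k) := by
          rw [Finset.prod_const, Finset.card_univ, Fintype.card_fin, ← Real.rpow_natCast,
            ← Real.rpow_mul (hpos _).le]
          push_cast
          rw [one_div_mul_cancel (by positivity), Real.rpow_one]
  calc ∏ i, (n.1 i : ℝ) ^ (1 + 1 / (k + 1) : ℝ)
      = (∏ i, (n.1 i : ℝ)) * ∏ i, (n.1 i : ℝ) ^ (1 / (k + 1) : ℝ) := by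
        rw [← Finset.prod_mul_distrib]
        refine Finset.prod_congr rfl fun i _ => ?_
        rw [Real.rpow_add (hpos i), Real.rpow_one]
    _ ≤ (∏ i, (n.1 i : ℝ)) * n.1 (Fin.last k) :=
        mul_le_mul_of_nonneg_left h2 (Finset.prod_nonneg fun i _ => (hpos i).le)
    _ ≤ ∏ i, (n.1 i : ℝ) ^ (r i : ℕ) := by
        rw [Fin.prod_univ_castSucc, Fin.prod_univ_castSucc, mul_assoc, ← sq]
        refine mul_le_mul (Finset.prod_le_prod (fun i _ => (hpos _).le) fun i _ => ?_) ?_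
          (by positivity) (Finset.prod_nonneg fun i _ => by positivity)
        · exact le_self_pow₀ (h1 _) (r _).pos.ne'
        · exact pow_le_pow_right₀ (h1 _) hr

/-! ### The series as holomorphic functions -/

/-- The coefficient `n₁^{-r₁} ⋯ nₖ^{-rₖ}`. -/
def seqCoeff {k : ℕ} (r : Fin (k + 1) → ℕ+) (n : Indices k) : ℂ :=
  ∏ i, ((n.1 i : ℂ) ^ (r i : ℕ))⁻¹

theorem norm_seqCoeff {k : ℕ} (r : Fin (k + 1) → ℕ+) (n : Indices k) :
    ‖seqCoeff r n‖ = ∏ i, ((n.1 i : ℝ) ^ (r i : ℕ))⁻¹ := by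
  simp [seqCoeff]

theorem norm_seqCoeff_le_one {k : ℕ} (r : Fin (k + 1) → ℕ+) (n : Indices k) :
    ‖seqCoeff r n‖ ≤ 1 := by
  rw [norm_seqCoeff]
  refine Finset.prod_le_one (fun i _ => by positivity) fun i _ => ?_
  refine inv_le_one_of_one_le₀ (one_le_pow₀ ?_)
  exact_mod_cast n.pos i

theorem polylogSeries_eq {k : ℕ} (r : Fin (k + 1) → ℕ+) (z : ℂ) :
    polylogSeries r z = ∑' n : Indices k, seqCoeff r n * z ^ n.1 (Fin.last k) := rfl

theorem summable_polylog {k : ℕ} (r : Fin (k + 1) → ℕ+) {z : ℂ} (hz : z ∈ ball (0 : ℂ) 1) :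
    Summable fun n : Indices k => seqCoeff r n * z ^ n.1 (Fin.last k) := by
  refine .of_norm_bounded (summable_pow_last (norm_nonneg z) (by simpa using hz) k) fun n => ?_
  rw [norm_mul, norm_pow]
  exact mul_le_of_le_one_left (by positivity) (norm_seqCoeff_le_one r n)

theorem polylogSeries_zero {k : ℕ} (r : Fin (k + 1) → ℕ+) : polylogSeries r 0 = 0 := by
  rw [polylogSeries_eq]
  refine (tsum_congr fun n => ?_).trans tsum_zero
  rw [zero_pow (n.pos _).ne', mul_zero]

theorem hasSum_of_forall_eq {ι : Type*} {f g : ι → ℂ} {s : ℂ} (h : HasSum f s)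
    (e : ∀ i, f i = g i) : HasSum g s := (funext e : f = g) ▸ h

theorem hasSum_prod_mul {ι κ : Type*} {f : ι → ℂ} {g : κ → ℂ} {s t : ℂ} (hf : HasSum f s)
    (hg : HasSum g t) (hf' : Summable fun i => ‖f i‖) (hg' : Summable fun j => ‖g j‖) :
    HasSum (fun p : ι × κ => f p.1 * g p.2) (s * t) :=
  hf.mul hg (summable_mul_of_summable_norm hf' hg')

theorem polylogSeries_deriv_aux {k : ℕ} (r : Fin (k + 1) → ℕ+) {z : ℂ}
    (hz : z ∈ ball (0 : ℂ) 1) : DifferentiableAt ℂ (polylogSeries r) z ∧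
    HasSum (fun n : Indices k => seqCoeff r n * n.1 (Fin.last k) * z ^ n.1 (Fin.last k))
      (z * deriv (polylogSeries r) z) := by
  obtain ⟨R, hzR, hR⟩ := exists_between (show ‖z‖ < 1 by simpa using hz)
  have hR0 : 0 ≤ R := (norm_nonneg z).trans hzR.le
  have hzR' : z ∈ ball (0 : ℂ) R := by simpa using hzR
  have hb : ∀ (n : Indices k) (w : ℂ), w ∈ ball (0 : ℂ) R →
      ‖seqCoeff r n * w ^ n.1 (Fin.last k)‖ ≤ R ^ n.1 (Fin.last k) := by
    intro n w hw
    rw [norm_mul, norm_pow]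
    have hw' : ‖w‖ ≤ R := by simpa using (mem_ball_zero_iff.1 hw).le
    exact (mul_le_of_le_one_left (by positivity) (norm_seqCoeff_le_one r n)).trans
      (pow_le_pow_left₀ (norm_nonneg w) hw' _)
  have hd : ∀ n : Indices k, DifferentiableOn ℂ
      (fun w => seqCoeff r n * w ^ n.1 (Fin.last k)) (ball 0 R) := fun n => by fun_prop
  have hs := summable_pow_last hR0 hR k
  refine ⟨(Complex.differentiableOn_tsum_of_summable_norm hs hd isOpen_ball hb).differentiableAt
    (isOpen_ball.mem_nhds hzR'), ?_⟩
  have h := (Complex.hasSum_deriv_of_summable_norm hs hd isOpen_ball hb hzR').mul_left z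
  refine hasSum_of_forall_eq h fun n => ?_
  obtain ⟨m, hm⟩ : ∃ m, n.1 (Fin.last k) = m + 1 := ⟨_, (Nat.succ_pred_eq_of_pos (n.pos _)).symm⟩
  rw [deriv_const_mul_field, deriv_pow_field, hm]
  simp only [Nat.add_sub_cancel]
  ring

theorem differentiableOn_polylogSeries {k : ℕ} (r : Fin (k + 1) → ℕ+) :
    DifferentiableOn ℂ (polylogSeries r) (ball 0 1) :=
  fun _ hz => (polylogSeries_deriv_aux r hz).1.differentiableWithinAt

theorem mul_deriv_polylogSeries_one {z : ℂ} (hz : z ∈ ball (0 : ℂ) 1) :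
    z * deriv (polylogSeries (k := 0) fun _ => 1) z = z * (1 - z)⁻¹ := by
  refine (polylogSeries_deriv_aux (k := 0) (fun _ => 1) hz).2.unique ?_
  rw [← indicesZeroEquiv.hasSum_iff]
  refine hasSum_of_forall_eq
    ((hasSum_geometric_of_norm_lt_one (show ‖z‖ < 1 by simpa using hz)).mul_left z) fun m => ?_
  have h : (m + 1 : ℂ) ≠ 0 := by exact_mod_cast m.succ_ne_zero
  simp [seqCoeff, h, pow_succ']

theorem mul_deriv_polylogSeries_incr {k : ℕ} (r : Fin (k + 1) → ℕ+) {z : ℂ}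
    (hz : z ∈ ball (0 : ℂ) 1) :
    z * deriv (polylogSeries (Function.update r (Fin.last k) (r (Fin.last k) + 1))) z =
      polylogSeries r z := by
  refine (polylogSeries_deriv_aux _ hz).2.unique ?_
  refine hasSum_of_forall_eq (summable_polylog r hz).hasSum fun n => ?_
  congr 1
  have hn : (n.1 (Fin.last k) : ℂ) ≠ 0 := by exact_mod_cast (n.pos _).ne'
  simp only [seqCoeff, Fin.prod_univ_castSucc, Function.update_self]
  have : ∀ i : Fin k, Function.update r (Fin.last k) (r (Fin.last k) + 1) i.castSucc =
      r i.castSucc := fun i => Function.update_of_ne (Fin.castSucc_lt_last i).ne _ _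
  simp only [this, PNat.add_coe, PNat.one_coe, pow_succ]
  field_simp

/-- Applying `z d/dz` cancels the last denominator, and the sum over the last increment is then a
geometric series. -/
theorem mul_deriv_polylogSeries_snoc {k : ℕ} (r : Fin (k + 1) → ℕ+) {z : ℂ}
    (hz : z ∈ ball (0 : ℂ) 1) :
    z * deriv (polylogSeries (Fin.snoc r 1 : Fin (k + 2) → ℕ+)) z =
      polylogSeries r z * (z * (1 - z)⁻¹) := by
  have hz' : ‖z‖ < 1 := by simpa using hz
  refine (polylogSeries_deriv_aux (Fin.snoc r 1 : Fin (k + 2) → ℕ+) hz).2.unique ?_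
  rw [← (indicesSuccEquiv k).hasSum_iff]
  have hg : HasSum (fun m : ℕ => z * z ^ m) (z * (1 - z)⁻¹) :=
    (hasSum_geometric_of_norm_lt_one hz').mul_left z
  have hg' : Summable fun m : ℕ => ‖z * z ^ m‖ := by
    simpa [norm_mul, norm_pow] using
      (summable_geometric_of_lt_one (norm_nonneg z) hz').mul_left ‖z‖
  have hr := summable_polylog r hz
  refine hasSum_of_forall_eq (hasSum_prod_mul hr.hasSum hg hr.norm hg') fun p => ?_
  have hn : ((p.1.1 (Fin.last k) + 1 + p.2 : ℕ) : ℂ) ≠ 0 := by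
    rw [Nat.cast_ne_zero]
    omega
  have hc : seqCoeff (Fin.snoc r 1 : Fin (k + 2) → ℕ+) (indicesSuccEquiv k p) =
      seqCoeff r p.1 * ((p.1.1 (Fin.last k) + 1 + p.2 : ℕ) : ℂ)⁻¹ := by
    rw [seqCoeff, Fin.prod_univ_castSucc (n := k + 1), seqCoeff]
    simp only [Fin.snoc_last, Fin.snoc_castSucc, indicesSuccEquiv_last, indicesSuccEquiv_castSucc,
      PNat.one_coe, pow_one]
  rw [Function.comp_apply, hc, indicesSuccEquiv_last, inv_mul_cancel_right₀ hn]
  ring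

theorem hasDerivAt_discWord_snoc_a {z : ℂ} (hz : z ∈ ball (0 : ℂ) 1) (hz0 : z ≠ 0) (v : Word) :
    HasDerivAt (discWord (.a :: v ++ [.a])) (discWord (.a :: v) z * (1 - z)⁻¹) z :=
  ((discWord_spec (.a :: v ++ [.a])).2.2 z hz hz0).congr_deriv (by
    rw [List.getLast?_append, List.dropLast_concat]; simp [div_eq_mul_inv])

theorem hasDerivAt_discWord_snoc_b {z : ℂ} (hz : z ∈ ball (0 : ℂ) 1) (hz0 : z ≠ 0) (v : Word) :
    HasDerivAt (discWord (.a :: v ++ [.b])) (discWord (.a :: v) z / z) z :=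
  ((discWord_spec (.a :: v ++ [.b])).2.2 z hz hz0).congr_deriv (by
    rw [List.getLast?_append, List.dropLast_concat]; simp)

theorem eqOn_ball_of_deriv {f g g' : ℂ → ℂ} (hf : DifferentiableOn ℂ f (ball 0 1))
    (hg : DifferentiableOn ℂ g (ball 0 1)) (h0 : g 0 = f 0)
    (hg' : ∀ z ∈ ball (0 : ℂ) 1, z ≠ 0 → HasDerivAt g (g' z) z)
    (h : ∀ z ∈ ball (0 : ℂ) 1, z ≠ 0 → z * deriv f z = z * g' z) {z : ℂ}
    (hz : z ∈ ball (0 : ℂ) 1) : g z = f z := by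
  have := eq_of_deriv_eq_zero_of_ne isOpen_ball (convex_ball _ _) (mem_ball_self one_pos)
    (hg.sub hf) (fun z hz hz0 => by
      have hfz := (hf.differentiableAt (isOpen_ball.mem_nhds hz)).hasDerivAt
      rw [((hg' z hz hz0).sub hfz).deriv, mul_left_cancel₀ hz0 (h z hz hz0), sub_self]) hz
  simpa [h0, sub_eq_zero] using this

theorem discWord_seqWord {k : ℕ} (r : Fin (k + 1) → ℕ+) : ∀ z ∈ ball (0 : ℂ) 1,
    discWord (seqWord r) z = polylogSeries r z := by
  have hzero : ∀ {k : ℕ} (r : Fin (k + 1) → ℕ+),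
      discWord (seqWord r) 0 = polylogSeries r 0 := by
    intro k r
    obtain ⟨v, hv⟩ := exists_seqWord_eq_cons r
    rw [polylogSeries_zero, (discWord_spec _).2.1, hv]
    simp
  induction k, r using seq_induction with
  | one =>
    intro z hz
    refine eqOn_ball_of_deriv (differentiableOn_polylogSeries _) (discWord_spec _).1 (hzero _)
      (g' := fun z => (1 - z)⁻¹) (fun z hz hz0 => ?_)
      (fun z hz _ => mul_deriv_polylogSeries_one hz) hz
    have h1 : discWord [] z = 1 := by rw [discWord]
    rw [seqWord_one]
    exact ((discWord_spec [.a]).2.2 z hz hz0).congr_deriv (by simp [h1])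
  | snoc k r ih =>
    intro z hz
    refine eqOn_ball_of_deriv (differentiableOn_polylogSeries _) (discWord_spec _).1 (hzero _)
      (g' := fun z => polylogSeries r z * (1 - z)⁻¹) (fun z hz hz0 => ?_)
      (fun z hz _ => by rw [mul_deriv_polylogSeries_snoc r hz]; ring) hz
    obtain ⟨v, hv⟩ := exists_seqWord_eq_cons r
    rw [seqWord_snoc, ← ih z hz, hv]
    exact hasDerivAt_discWord_snoc_a hz hz0 v
  | incr k r ih =>
    intro z hz
    refine eqOn_ball_of_deriv (differentiableOn_polylogSeries _) (discWord_spec _).1 (hzero _)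
      (g' := fun z => polylogSeries r z / z) (fun z hz hz0 => ?_)
      (fun z hz hz0 => by rw [mul_deriv_polylogSeries_incr r hz, mul_div_cancel₀ _ hz0]) hz
    obtain ⟨v, hv⟩ := exists_seqWord_eq_cons r
    rw [seqWord_incr, ← ih z hz, hv]
    exact hasDerivAt_discWord_snoc_b hz hz0 v

theorem polylogChar_seqWord {k : ℕ} (r : Fin (k + 1) → ℕ+) {z : ℂ} (hz : z ∈ ball (0 : ℂ) 1) :
    polylogChar z (word (seqWord r)) = polylogSeries r z := by
  rw [← discWord_seqWord r z hz]
  obtain ⟨v, hv⟩ := exists_seqWord_eq_cons r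
  rw [hv, polylogChar_a_cons]

/-- Since `|z| < 1`, the absolutely convergent series at 1 dominates, for any approach within the
disc. -/
theorem tendsto_polylogSeries {k : ℕ} (r : Fin (k + 1) → ℕ+) (hr : 2 ≤ r (Fin.last k)) :
    Filter.Tendsto (polylogSeries r) (𝓝[ball 0 1] 1) (𝓝 (polyzetaSeries r)) := by
  refine tendsto_tsum_of_dominated_convergence (summable_polyzeta r hr) (fun n => ?_) ?_
  · have : ContinuousAt (fun z : ℂ => seqCoeff r n * z ^ n.1 (Fin.last k)) 1 := by fun_prop
    have := this.tendsto.mono_left (nhdsWithin_le_nhds (s := ball (0 : ℂ) 1))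
    rwa [one_pow, mul_one] at this
  · filter_upwards [self_mem_nhdsWithin] with z hz n
    have hz' : ‖z‖ < 1 := by simpa using hz
    change ‖seqCoeff r n * _‖ ≤ _
    rw [norm_mul, norm_pow, norm_seqCoeff]
    exact mul_le_of_le_one_right (Finset.prod_nonneg fun i _ => by positivity)
      (pow_le_one₀ (norm_nonneg z) hz'.le)

open Filter Asymptotics

/-! ### Growth near `1` -/

theorem hasDerivAt_polylogChar_snoc_a {z : ℂ} (hz : z ∈ Omega) (w : Word) :
    HasDerivAt (fun z => polylogChar z (word (w ++ [.a])))
      ((1 - z)⁻¹ * polylogChar z (word w)) z := by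
  have h := hasDerivAt_polylogChar hz (word (w ++ [.a]))
  rwa [LinearMap.add_apply, LinearMap.smul_apply, LinearMap.smul_apply, LinearMap.comp_apply,
    LinearMap.comp_apply, deleteLast_snoc, deleteLast_snoc, if_pos rfl, if_neg (by decide),
    map_zero, smul_zero, add_zero, smul_eq_mul] at h

theorem hasDerivAt_polylogChar_snoc_b {z : ℂ} (hz : z ∈ Omega) (w : Word) :
    HasDerivAt (fun z => polylogChar z (word (w ++ [.b]))) (z⁻¹ * polylogChar z (word w)) z := by
  have h := hasDerivAt_polylogChar hz (word (w ++ [.b]))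
  rwa [LinearMap.add_apply, LinearMap.smul_apply, LinearMap.smul_apply, LinearMap.comp_apply,
    LinearMap.comp_apply, deleteLast_snoc, deleteLast_snoc, if_neg (by decide), if_pos rfl,
    map_zero, smul_zero, zero_add, smul_eq_mul] at h

/-- A path that tends to `1` at `+∞` along a ray. -/
def rayPath (ξ : ℂ) (s : ℝ) : ℂ := 1 - Real.exp (-s) * ξ

theorem hasDerivAt_rayPath (ξ : ℂ) (s : ℝ) : HasDerivAt (rayPath ξ) (1 - rayPath ξ s) s := by
  have h1 : HasDerivAt (fun s : ℝ => Real.exp (-s)) (Real.exp (-s) * -1) s :=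
    (hasDerivAt_neg s).exp
  refine ((h1.ofReal_comp.mul_const ξ).const_sub 1).congr_deriv ?_
  simp [rayPath]

theorem tendsto_rayPath (ξ : ℂ) : Tendsto (rayPath ξ) atTop (𝓝 1) := by
  have h : Tendsto (fun s : ℝ => ((Real.exp (-s) : ℝ) : ℂ)) atTop (𝓝 ((0 : ℝ) : ℂ)) :=
    (Complex.continuous_ofReal.tendsto 0).comp
      (Real.tendsto_exp_atBot.comp tendsto_neg_atTop_atBot)
  have h1 := (h.mul_const ξ).const_sub 1
  rw [Complex.ofReal_zero, zero_mul, sub_zero] at h1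
  exact h1

theorem exp_neg_le_third {s : ℝ} (hs : 2 ≤ s) : Real.exp (-s) ≤ 1 / 3 := by
  rw [Real.exp_neg, one_div]
  refine inv_anti₀ (by norm_num) ?_
  linarith [Real.add_one_le_exp s]

theorem norm_one_sub_rayPath_le {ξ : ℂ} (hξ : ‖ξ‖ ≤ 3 / 2) {s : ℝ} (hs : 2 ≤ s) :
    ‖1 - rayPath ξ s‖ ≤ ‖rayPath ξ s‖ := by
  have h1 : ‖1 - rayPath ξ s‖ ≤ 1 / 2 := by
    have : 1 - rayPath ξ s = Real.exp (-s) * ξ := by simp [rayPath]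
    rw [this, norm_mul, Complex.norm_real, Real.norm_of_nonneg (Real.exp_pos _).le]
    calc Real.exp (-s) * ‖ξ‖ ≤ 1 / 3 * (3 / 2) :=
          mul_le_mul (exp_neg_le_third hs) hξ (norm_nonneg _) (by norm_num)
      _ = 1 / 2 := by norm_num
  have h2 := norm_sub_norm_le (1 : ℂ) (1 - rayPath ξ s)
  rw [sub_sub_cancel, norm_one] at h2
  linarith

/-- Along the path `ω_a` becomes `ds` and `ω_b` is at most `ds` in size, so each letter costs one
integration in `s`. The bound `exp(s/2)` reproduces itself up to a constant, and stays below the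
`exp(s)` needed later. -/
theorem exists_norm_polylogChar_rayPath_le {ξ : ℂ} (hξ : ‖ξ‖ ≤ 3 / 2)
    (hpath : ∀ s, 2 ≤ s → rayPath ξ s ∈ Omega) (w : Word) :
    ∃ C : ℝ, 0 ≤ C ∧ ∀ s, 2 ≤ s → ‖polylogChar (rayPath ξ s) (word w)‖ ≤ C * Real.exp (s / 2) := by
  induction w using List.reverseRecOn with
  | nil =>
    refine ⟨1, zero_le_one, fun s hs => ?_⟩
    rw [(isShuffleMorphism_polylogChar (hpath s hs)).1, norm_one, one_mul]
    exact Real.one_le_exp (by linarith)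
  | append_singleton w c ih =>
    obtain ⟨C, hC, h⟩ := ih
    set f : ℝ → ℂ := fun s => polylogChar (rayPath ξ s) (word (w ++ [c])) with hf
    obtain ⟨f', hf', hfb⟩ : ∃ f' : ℝ → ℂ, (∀ s, 2 ≤ s → HasDerivAt f (f' s) s) ∧
        ∀ s, 2 ≤ s → ‖f' s‖ ≤ C * Real.exp (s / 2) := by
      cases c
      · refine ⟨fun s => polylogChar (rayPath ξ s) (word w), fun s hs => ?_, h⟩
        refine ((hasDerivAt_polylogChar_snoc_a (hpath s hs) w).comp s
          (hasDerivAt_rayPath ξ s)).congr_deriv ?_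
        have := one_sub_ne_zero_of_mem_ball (mem_ball_of_mem_Omega (hpath s hs))
        field_simp
      · refine ⟨fun s => (rayPath ξ s)⁻¹ * polylogChar (rayPath ξ s) (word w) *
          (1 - rayPath ξ s), fun s hs => ?_, fun s hs => ?_⟩
        · exact (hasDerivAt_polylogChar_snoc_b (hpath s hs) w).comp s (hasDerivAt_rayPath ξ s)
        · refine le_trans ?_ (h s hs)
          have h0 : 0 < ‖rayPath ξ s‖ := norm_pos_iff.2 (ne_zero_of_mem_Omega (hpath s hs))
          rw [norm_mul, norm_mul, norm_inv, mul_right_comm, inv_mul_eq_div]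
          exact mul_le_of_le_one_left (norm_nonneg _)
            ((div_le_one h0).2 (norm_one_sub_rayPath_le hξ hs))
    refine ⟨‖f 2‖ + 2 * C, by positivity, fun s hs => ?_⟩
    have hB : ∀ x : ℝ, HasDerivAt (fun x => ‖f 2‖ + 2 * C * Real.exp (x / 2))
        (C * Real.exp (x / 2)) x := fun x =>
      ((((hasDerivAt_id x).div_const 2).exp.const_mul (2 * C)).const_add _).congr_deriv (by
        simp only [id]; ring)
    have := image_norm_le_of_norm_deriv_right_le_deriv_boundary (f := f) (f' := f') (a := 2)
      (b := s) (B := fun x => ‖f 2‖ + 2 * C * Real.exp (x / 2)) (fun x hx => (hf' x hx.1).continuousAt.continuousWithinAt)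
      (fun x hx => (hf' x hx.1).hasDerivWithinAt)
      (le_add_of_nonneg_right (by positivity)) hB (fun x hx => hfb x hx.1)
      (Set.right_mem_Icc.2 hs)
    refine this.trans ?_
    rw [add_mul]
    have h1 : 1 ≤ Real.exp (s / 2) := Real.one_le_exp (by linarith)
    nlinarith [norm_nonneg (f 2)]

/-- Words that start with `a` give functions that vanish to first order at `0`. -/
theorem isBigO_polylogChar {h : H} (hh : h ∈ spanStartA) :
    (fun y => polylogChar y h) =O[𝓝 0] fun y : ℂ => y := by
  induction hh using Submodule.span_induction with
  | mem x hx =>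
    obtain ⟨v, rfl⟩ := hx
    have h1 := ((discWord_spec (.a :: v)).1.differentiableAt
      (ball_mem_nhds (0 : ℂ) one_pos)).isBigO_sub
    simpa [polylogChar_a_cons, (discWord_spec (.a :: v)).2.1] using h1
  | zero => simpa using isBigO_zero _ _
  | add x y _ _ hx hy => simpa using hx.add hy
  | smul q x _ hx => simpa [Algebra.smul_def] using hx.const_mul_left (q : ℂ)

/-! ### Constancy of the convolution with a pulled back functional -/

section Pullback

variable {f : Letter → H} {α β : Letter → ℚ} {U : Set ℂ} {φ φ' : ℂ → ℂ}

/-- The conditions `ha` and `hb` say that `φ` pulls the form attached to `f c` back to `-ω_c`. -/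
theorem hasDerivAt_conv_pullback (hf : ∀ c, f c = α c • letter .a + β c • letter .b) {z : ℂ}
    (hz : z ∈ Omega) (hφz : φ z ∈ Omega) {d : ℂ} (hφ' : HasDerivAt φ d z)
    (ha : d * (α .a * (1 - φ z)⁻¹ + β .a * (φ z)⁻¹) = -(1 - z)⁻¹)
    (hb : d * (α .b * (1 - φ z)⁻¹ + β .b * (φ z)⁻¹) = -z⁻¹) (h : H) :
    HasDerivAt (fun z => conv (polylogChar z) (polylogChar (φ z) ∘ₗ antiExtend f) h) 0 z := by
  set G : H →ₗ[ℚ] ℂ := polylogChar (φ z) ∘ₗ antiExtend f with hG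
  have h2 : ∀ h, HasDerivAt (fun z => (polylogChar (φ z) ∘ₗ antiExtend f) h)
      ((-(1 - z)⁻¹ • G ∘ₗ deleteHead .a + -z⁻¹ • G ∘ₗ deleteHead .b) h) z := by
    intro h
    refine ((hasDerivAt_polylogChar hφz (antiExtend f h)).comp z hφ').congr_deriv ?_
    have e1 := LinearMap.congr_fun (deleteLast_a_comp_antiExtend hf) h
    have e2 := LinearMap.congr_fun (deleteLast_b_comp_antiExtend hf) h
    simp only [LinearMap.comp_apply, LinearMap.add_apply, LinearMap.smul_apply] at e1 e2
    simp only [LinearMap.comp_apply, LinearMap.add_apply, LinearMap.smul_apply, e1, e2, hG,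
      map_add, map_smul, ← ha, ← hb, Algebra.smul_def, Algebra.algebraMap_self, RingHom.id_apply,
      eq_ratCast]
    ring
  refine (hasDerivAt_conv (hasDerivAt_polylogChar hz) h2 h).congr_deriv ?_
  rw [conv_add_left, conv_add_right, conv_smul_left, conv_smul_left, conv_smul_right,
    conv_smul_right, conv_deleteLast_left, conv_deleteLast_left]
  simp only [LinearMap.add_apply, LinearMap.smul_apply, smul_eq_mul]
  ring

theorem conv_pullback_seqWord (hf : ∀ c, f c = α c • letter .a + β c • letter .b)
    (hβ : β .b = 0) (hU : IsOpen U) (hc : Convex ℝ U) (hUO : U ⊆ Omega)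
    (hφ : ∀ z ∈ U, φ z ∈ Omega) (hφ' : ∀ z ∈ U, HasDerivAt φ (φ' z) z)
    (ha : ∀ z ∈ U, φ' z * (α .a * (1 - φ z)⁻¹ + β .a * (φ z)⁻¹) = -(1 - z)⁻¹)
    (hb : ∀ z ∈ U, φ' z * (α .b * (1 - φ z)⁻¹ + β .b * (φ z)⁻¹) = -z⁻¹)
    {ξ : ℂ} (hξ : ‖ξ‖ ≤ 3 / 2) (hpath : ∀ s, 2 ≤ s → rayPath ξ s ∈ U)
    (hφ1 : (fun s => φ (rayPath ξ s)) =O[atTop] fun s => Real.exp (-s))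
    {k : ℕ} (r : Fin (k + 1) → ℕ+) (hr : 2 ≤ r (Fin.last k)) {z : ℂ} (hz : z ∈ U) :
    conv (polylogChar z) (polylogChar (φ z) ∘ₗ antiExtend f) (word (seqWord r)) =
      polyzetaSeries r := by
  set g : ℂ → ℂ := fun z =>
    conv (polylogChar z) (polylogChar (φ z) ∘ₗ antiExtend f) (word (seqWord r)) with hg
  have hgd : ∀ z ∈ U, HasDerivAt g 0 z := fun z hz =>
    hasDerivAt_conv_pullback hf (hUO hz) (hφ z hz) (hφ' z hz) (ha z hz) (hb z hz) _
  have hconst : ∀ s, 2 ≤ s → g (rayPath ξ s) = g z := fun s hs =>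
    hU.is_const_of_deriv_eq_zero hc.isPreconnected
      (fun x hx => (hgd x hx).differentiableAt.differentiableWithinAt)
      (fun x hx => (hgd x hx).deriv) (hpath s hs) hz
  have hlim1 : Tendsto (fun s => g (rayPath ξ s)) atTop (𝓝 (g z)) := by
    refine tendsto_const_nhds.congr' ?_
    filter_upwards [eventually_ge_atTop 2] with s hs using (hconst s hs).symm
  refine tendsto_nhds_unique hlim1 ?_
  obtain ⟨r', hr'⟩ := exists_incr_eq r hr
  obtain ⟨v, hv⟩ : ∃ v, seqWord r = v ++ [.b] := ⟨_, by rw [hr', seqWord_incr]⟩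
  have hφ0 : Tendsto (fun s => φ (rayPath ξ s)) atTop (𝓝 0) :=
    hφ1.trans_tendsto (Real.tendsto_exp_atBot.comp tendsto_neg_atTop_atBot)
  -- Growth `exp(s/2)` of the first factor meets decay `exp(-s)` of the second.
  have hsmall : ∀ u : Word, ∀ h ∈ spanStartA, Tendsto
      (fun s => polylogChar (rayPath ξ s) (word u) * polylogChar (φ (rayPath ξ s)) h)
      atTop (𝓝 0) := by
    intro u h hh
    obtain ⟨C, -, hC⟩ := exists_norm_polylogChar_rayPath_le hξ (fun s hs => hUO (hpath s hs)) u
    have h1 : (fun s => polylogChar (rayPath ξ s) (word u)) =O[atTop]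
        fun s => Real.exp (s / 2) := by
      refine IsBigO.of_bound C ?_
      filter_upwards [eventually_ge_atTop 2] with s hs
      simpa [abs_of_pos (Real.exp_pos _)] using hC s hs
    have h2 := ((isBigO_polylogChar hh).comp_tendsto hφ0).trans hφ1
    refine (h1.mul h2).trans_tendsto ?_
    have h3 : Tendsto (fun s : ℝ => Real.exp (-(s / 2))) atTop (𝓝 0) :=
      Real.tendsto_exp_atBot.comp (tendsto_neg_atTop_atBot.comp
        (tendsto_id.atTop_div_const two_pos))
    refine h3.congr fun s => ?_
    rw [← Real.exp_add]
    congr 1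
    ring
  have hmain : Tendsto (fun s => polylogChar (rayPath ξ s) (word (seqWord r))) atTop
      (𝓝 (polyzetaSeries r)) := by
    have h1 : Tendsto (rayPath ξ) atTop (𝓝[ball 0 1] 1) := by
      refine tendsto_nhdsWithin_iff.2 ⟨tendsto_rayPath ξ, ?_⟩
      filter_upwards [eventually_ge_atTop 2] with s hs
      exact mem_ball_of_mem_Omega (hUO (hpath s hs))
    refine ((tendsto_polylogSeries r hr).comp h1).congr' ?_
    filter_upwards [eventually_ge_atTop 2] with s hs
    exact (polylogChar_seqWord r (mem_ball_of_mem_Omega (hUO (hpath s hs)))).symm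
  -- The factorization with empty second factor is split off; in all others the second factor ends
  -- with `b`, so its image lies in `spanStartA`.
  have hsum : ∀ᶠ s in atTop, g (rayPath ξ s) =
      ∑ i ∈ Finset.range (v.length + 1), polylogChar (rayPath ξ s) (word (v.take i)) *
        polylogChar (φ (rayPath ξ s)) (antiExtend f (word (v.drop i ++ [.b]))) +
      polylogChar (rayPath ξ s) (word (seqWord r)) := by
    filter_upwards [eventually_ge_atTop 2] with s hs
    simp only [hg, hv]
    rw [conv_word_eq_sum, List.length_append, List.length_singleton, Finset.sum_range_succ]
    congr 1
    · refine Finset.sum_congr rfl fun i hi => ?_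
      have hi' : i ≤ v.length := Nat.lt_succ_iff.1 (Finset.mem_range.1 hi)
      rw [List.take_append_of_le_length hi', List.drop_append_of_le_length hi',
        LinearMap.comp_apply]
    · have h1 : (v ++ [Letter.b]).length = v.length + 1 := by simp
      rw [← h1, List.take_length, List.drop_length, LinearMap.comp_apply, antiExtend_nil,
        (isShuffleMorphism_polylogChar (hφ _ (hpath s hs))).1, mul_one]
  refine Tendsto.congr' (hsum.mono fun _ h => h.symm) ?_
  have := (tendsto_finsetSum (Finset.range (v.length + 1)) fun i _ =>
    hsmall (v.take i) _ (antiExtend_mem_spanStartA hf hβ (v.drop i))).add hmain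
  simpa using this

end Pullback

/-! ### Limits at points of the unit circle -/

theorem mem_Omega_and_norm_inv_le {p : ℂ} (hp1 : ‖1 - p‖ = 1) (hp : ‖p‖ = 1) (him : 1 / 2 ≤ |p.im|) {z : ℂ}
    (hz : z ∈ ball (0 : ℂ) 1 ∩ ball p (1 / 2)) :
    z ∈ Omega ∧ ‖z⁻¹‖ ≤ 2 ∧ ‖(1 - z)⁻¹‖ ≤ 2 := by
  have hd : ‖p - z‖ < 1 / 2 := by
    have := hz.2
    rwa [mem_ball, dist_comm, dist_eq_norm] at this
  refine ⟨⟨hz.1, ?_⟩, ?_, ?_⟩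
  · refine Complex.mem_slitPlane_iff.2 (.inr fun h => ?_)
    have := Complex.abs_im_le_norm (p - z)
    rw [Complex.sub_im, h, sub_zero] at this
    linarith
  · rw [norm_inv]
    refine inv_le_of_inv_le₀ two_pos ?_
    have := norm_sub_norm_le p z
    linarith
  · rw [norm_inv]
    refine inv_le_of_inv_le₀ two_pos ?_
    have h1 : ‖1 - p‖ ≤ ‖1 - z‖ + ‖z - p‖ := by
      have := norm_add_le (1 - z) (z - p)
      rwa [sub_add_sub_cancel] at this
    rw [norm_sub_rev z p] at h1
    linarith

/-- Near `p` both `1/z` and `1/(1-z)` are at most 2 in size. A bound for a word thus bounds the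
derivative after one more letter, and convexity gives the Lipschitz estimate and the next bound. -/
theorem lipschitz_polylogChar {p : ℂ} (hp1 : ‖1 - p‖ = 1) (hp : ‖p‖ = 1) (him : 1 / 2 ≤ |p.im|)
    (w : Word) :
    (∃ C : ℝ, ∀ z ∈ ball (0 : ℂ) 1 ∩ ball p (1 / 2), ‖polylogChar z (word w)‖ ≤ C) ∧
    ∃ K, LipschitzOnWith K (fun z => polylogChar z (word w)) (ball (0 : ℂ) 1 ∩ ball p (1 / 2)) := by
  set V := ball (0 : ℂ) 1 ∩ ball p (1 / 2) with hV
  have hVc : Convex ℝ V := (convex_ball _ _).inter (convex_ball _ _)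
  have hx₀ : (3 / 4 : ℂ) * p ∈ V := by
    constructor
    · rw [mem_ball_zero_iff, norm_mul, hp]; norm_num
    · have : (3 / 4 : ℂ) * p - p = -(1 / 4) * p := by ring
      rw [mem_ball, dist_eq_norm, this, norm_mul, hp]; norm_num
  induction w using List.reverseRecOn with
  | nil =>
    have h1 : ∀ z ∈ V, polylogChar z (word []) = 1 := fun z hz =>
      (isShuffleMorphism_polylogChar (mem_Omega_and_norm_inv_le hp1 hp him hz).1).1
    refine ⟨⟨1, fun z hz => by simp [h1 z hz]⟩, 0, ?_⟩
    refine LipschitzOnWith.of_dist_le_mul fun x hx y hy => ?_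
    simp [h1 x hx, h1 y hy]
  | append_singleton w c ih =>
    obtain ⟨⟨C, hC⟩, -⟩ := ih
    have hC0 : 0 ≤ C := (norm_nonneg _).trans (hC _ hx₀)
    obtain ⟨f', hf', hb⟩ : ∃ f' : ℂ → ℂ,
        (∀ z ∈ V, HasDerivAt (fun z => polylogChar z (word (w ++ [c]))) (f' z) z) ∧
        ∀ z ∈ V, ‖f' z‖ ≤ 2 * C := by
      cases c
      · refine ⟨_, fun z hz => hasDerivAt_polylogChar_snoc_a
          (mem_Omega_and_norm_inv_le hp1 hp him hz).1 w, fun z hz => ?_⟩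
        rw [norm_mul]
        exact mul_le_mul (mem_Omega_and_norm_inv_le hp1 hp him hz).2.2 (hC z hz) (norm_nonneg _) two_pos.le
      · refine ⟨_, fun z hz => hasDerivAt_polylogChar_snoc_b
          (mem_Omega_and_norm_inv_le hp1 hp him hz).1 w, fun z hz => ?_⟩
        rw [norm_mul]
        exact mul_le_mul (mem_Omega_and_norm_inv_le hp1 hp him hz).2.1 (hC z hz) (norm_nonneg _) two_pos.le
    have hlip : ∀ x ∈ V, ∀ y ∈ V,
        ‖polylogChar y (word (w ++ [c])) - polylogChar x (word (w ++ [c]))‖ ≤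
          2 * C * ‖y - x‖ := fun x hx y hy =>
      hVc.norm_image_sub_le_of_norm_hasDerivWithin_le
        (f := fun z => polylogChar z (word (w ++ [c])))
        (fun z hz => (hf' z hz).hasDerivWithinAt) hb hx hy
    constructor
    · refine ⟨2 * C * 2 + ‖polylogChar (3 / 4 * p) (word (w ++ [c]))‖, fun z hz => ?_⟩
      have h1 := hlip _ hx₀ z hz
      have h2 := norm_sub_norm_le (polylogChar z (word (w ++ [c])))
        (polylogChar (3 / 4 * p) (word (w ++ [c])))
      have h3 : ‖z - 3 / 4 * p‖ ≤ 2 := by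
        have hz1 : ‖z‖ < 1 := by simpa using hz.1
        have hx1 : ‖3 / 4 * p‖ < 1 := by simpa using hx₀.1
        linarith [norm_sub_le z (3 / 4 * p)]
      nlinarith
    · refine ⟨(2 * C).toNNReal, LipschitzOnWith.of_dist_le_mul fun x hx y hy => ?_⟩
      rw [dist_eq_norm, dist_eq_norm, Real.coe_toNNReal _ (by positivity)]
      exact hlip y hy x hx

theorem exists_limit_polylogChar {p : ℂ} (hp1 : ‖1 - p‖ = 1) (hp : ‖p‖ = 1)
    (him : 1 / 2 ≤ |p.im|) : (𝓝[Omega] p).NeBot ∧ ∃ ψ : H →ₗ[ℚ] ℂ,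
    IsShuffleMorphism ψ ∧ ∀ h, Tendsto (fun z => polylogChar z h) (𝓝[Omega] p) (𝓝 (ψ h)) := by
  have hne : (𝓝[Omega] p).NeBot := by
    have h1 : Tendsto (fun t : ℝ => (1 - t : ℂ) * p) (𝓝[>] 0) (𝓝 p) := by
      have : ContinuousAt (fun t : ℝ => (1 - t : ℂ) * p) 0 := by fun_prop
      have := this.tendsto.mono_left (nhdsWithin_le_nhds (s := Set.Ioi (0 : ℝ)))
      simpa using this
    have h2 : Tendsto (fun t : ℝ => (1 - t : ℂ) * p) (𝓝[>] 0) (𝓝[Omega] p) := by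
      refine tendsto_nhdsWithin_iff.2 ⟨h1, ?_⟩
      filter_upwards [Ioo_mem_nhdsGT (show (0 : ℝ) < 1 / 2 by norm_num)] with t ht
      have e : ‖(1 - t : ℂ)‖ = 1 - t := by
        rw [← Complex.ofReal_one, ← Complex.ofReal_sub, Complex.norm_real,
          Real.norm_of_nonneg (by linarith [ht.2])]
      refine (mem_Omega_and_norm_inv_le hp1 hp him ⟨?_, ?_⟩).1
      · rw [mem_ball_zero_iff, norm_mul, hp, e]; linarith [ht.1]
      · have : (1 - t : ℂ) * p - p = -t * p := by ring
        rw [mem_ball, dist_eq_norm, this, norm_mul, hp, norm_neg, Complex.norm_real,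
          Real.norm_of_nonneg ht.1.le]
        linarith [ht.2]
    exact h2.neBot
  refine ⟨hne, ?_⟩
  have hV : 𝓝[Omega] p ≤ 𝓟 (ball (0 : ℂ) 1 ∩ ball p (1 / 2)) := by
    rw [le_principal_iff]
    filter_upwards [self_mem_nhdsWithin,
      nhdsWithin_le_nhds (ball_mem_nhds p (by norm_num : (0 : ℝ) < 1 / 2))] with z hz hz'
    exact ⟨hz.1, hz'⟩
  have hex : ∀ w : Word, ∃ l : ℂ, Tendsto (fun z => polylogChar z (word w)) (𝓝[Omega] p) (𝓝 l) := by
    intro w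
    obtain ⟨K, hK⟩ := (lipschitz_polylogChar hp1 hp him w).2
    exact CompleteSpace.complete
      ((cauchy_nhds.mono nhdsWithin_le_nhds).map_of_le hK.uniformContinuousOn hV)
  choose l hl using hex
  have hlim : ∀ h, Tendsto (fun z => polylogChar z h) (𝓝[Omega] p)
      (𝓝 (Finsupp.linearCombination ℚ l h)) := by
    intro h
    induction h using induction_word with
    | h0 => simp
    | hw w => simpa using hl w
    | hadd x y hx hy => simpa using hx.add hy
    | hsmul q x hx => simpa using hx.const_smul q
  refine ⟨_, ⟨?_, fun u v => ?_⟩, hlim⟩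
  · refine tendsto_nhds_unique (hlim (word [])) (tendsto_const_nhds.congr' ?_)
    filter_upwards [self_mem_nhdsWithin] with z hz
    exact (isShuffleMorphism_polylogChar hz).1.symm
  · refine tendsto_nhds_unique (hlim (shuffle u v)) (((hlim u).mul (hlim v)).congr' ?_)
    filter_upwards [self_mem_nhdsWithin] with z hz
    exact ((isShuffleMorphism_polylogChar hz).2 u v).symm

/-! ### The morphism of polylogarithms -/

/-- The morphism `h ↦ L_h`. -/
def polylogHom : H →ₗ[ℚ] Hol Omega where
  toFun h := ⟨fun z => polylogChar z h, fun z => polylogChar z h,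
    fun _ hz => (hasDerivAt_polylogChar hz h).differentiableAt.differentiableWithinAt,
    fun _ => rfl⟩
  map_add' x y := Subtype.ext (funext fun z => map_add (polylogChar z) x y)
  map_smul' q x := Subtype.ext (funext fun z => map_smul (polylogChar z) q x)

theorem isPolylogMorphism_polylogHom : IsPolylogMorphism polylogHom := by
  refine ⟨⟨?_, fun u v => ?_⟩, fun k r z => ?_, fun z => ?_⟩
  · exact Subtype.ext (funext fun z => (isShuffleMorphism_polylogChar z.2).1)
  · exact Subtype.ext (funext fun z => (isShuffleMorphism_polylogChar z.2).2 u v)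
  · exact polylogChar_seqWord r (mem_ball_of_mem_Omega z.2)
  · exact polylogChar_b z.2

theorem IsPolylogMorphism.unique {Φ Ψ : H →ₗ[ℚ] Hol Omega} (hΦ : IsPolylogMorphism Φ)
    (hΨ : IsPolylogMorphism Ψ) : Φ = Ψ := by
  refine hΦ.1.ext_startA hΨ.1 ?_ fun v => ?_
  · exact Subtype.ext (funext fun z => by rw [hΦ.2.2, hΨ.2.2])
  · obtain ⟨k, r, hr⟩ := exists_eq_seqWord v
    rw [hr]
    exact Subtype.ext (funext fun z => by rw [hΦ.2.1, hΨ.2.1])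

theorem existsUnique_isPolylogMorphism : ∃! Φ, IsPolylogMorphism Φ :=
  ⟨polylogHom, isPolylogMorphism_polylogHom, fun _ h => h.unique isPolylogMorphism_polylogHom⟩

theorem isPolylogMorphism_polylog : IsPolylogMorphism polylog :=
  Classical.epsilon_spec existsUnique_isPolylogMorphism.exists

theorem polylog_apply (h : H) (z : Omega) : (polylog h).1 z = polylogChar z h := by
  rw [isPolylogMorphism_polylog.unique isPolylogMorphism_polylogHom]
  rfl

theorem L_of_mem (h : H) {z : ℂ} (hz : z ∈ Omega) : L h z = polylogChar z h := by
  rw [L, dif_pos hz, polylog_apply]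

theorem tendsto_polylog {h : H} {p l : ℂ}
    (hl : Tendsto (fun z => polylogChar z h) (𝓝[Omega] p) (𝓝 l)) :
    Tendsto (polylog h).1 (comap ((↑) : Omega → ℂ) (𝓝 p)) (𝓝 l) := by
  have h1 : Tendsto ((↑) : Omega → ℂ) (comap ((↑) : Omega → ℂ) (𝓝 p)) (𝓝[Omega] p) :=
    tendsto_nhdsWithin_iff.2 ⟨tendsto_comap, Eventually.of_forall fun z => z.2⟩
  exact (hl.comp h1).congr fun z => (polylog_apply h z).symm

theorem L_of_tendsto {h : H} {p l : ℂ} (hp : p ∉ Omega) [hne : (𝓝[Omega] p).NeBot]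
    (hl : Tendsto (fun z => polylogChar z h) (𝓝[Omega] p) (𝓝 l)) : L h p = l := by
  have : (comap ((↑) : Omega → ℂ) (𝓝 p)).NeBot := by
    rw [← mem_closure_iff_comap_neBot, mem_closure_iff_nhdsWithin_neBot]
    exact hne
  rw [L, dif_neg hp]
  exact (tendsto_polylog hl).limUnder_eq

/-! ### The morphisms of polyzeta values -/

theorem IsZetaMorphism.unique {θ : ℂ} {ψ χ : H →ₗ[ℚ] ℂ} (hψ : IsZetaMorphism θ ψ)
    (hχ : IsZetaMorphism θ χ) : ψ = χ := by
  refine hψ.1.ext_startA_endB hχ.1 (by rw [hψ.2.2.1, hχ.2.2.1]) (by rw [hψ.2.2.2, hχ.2.2.2])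
    fun v => ?_
  obtain ⟨k, r, hr⟩ := exists_eq_seqWord v
  have h2 : 2 ≤ (Function.update r (Fin.last k) (r (Fin.last k) + 1)) (Fin.last k) := by
    rw [Function.update_self]
    exact add_le_add_left one_le 1
  rw [hr, ← seqWord_incr, hψ.2.1 _ _ h2, hχ.2.1 _ _ h2]

theorem IsZetaMorphism.existsUnique {θ : ℂ} {ψ : H →ₗ[ℚ] ℂ} (hψ : IsZetaMorphism θ ψ) :
    ∃! ψ, IsZetaMorphism θ ψ :=
  ⟨ψ, hψ, fun _ h => h.unique hψ⟩

theorem IsZetaMorphism.epsilon {θ : ℂ} {ψ : H →ₗ[ℚ] ℂ} (hψ : IsZetaMorphism θ ψ) :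
    IsZetaMorphism θ (Classical.epsilon (IsZetaMorphism θ)) :=
  Classical.epsilon_spec ⟨ψ, hψ⟩

theorem conv_antiExtend_letter {F : H →ₗ[ℚ] ℂ} (hF : IsShuffleMorphism F) {f : Letter → H}
    {α β : Letter → ℚ} (hf : ∀ c, f c = α c • letter .a + β c • letter .b) (c : Letter) :
    conv F (F ∘ₗ antiExtend f) (letter c) =
      F (letter c) + (α c * F (letter .a) + β c * F (letter .b)) := by
  have h : antiExtend f (word [c]) = α c • letter .a + β c • letter .b := by
    rw [← consMap_word, antiExtend_consMap hf, antiExtend_nil, snocMap_word, snocMap_word]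
    rfl
  rw [letter, conv_word]
  simp only [splitSum, LinearMap.comp_apply, h, antiExtend_nil, hF.1, map_add, map_smul, one_mul,
    mul_one, Algebra.smul_def, eq_ratCast]
  ring

theorem sigmaLetter_eq (c : Letter) : sigmaLetter c =
    (if c = .a then 0 else 1 : ℚ) • letter .a + (if c = .a then 1 else 0 : ℚ) • letter .b := by
  cases c <;> simp [sigmaLetter]

theorem tauLetter_eq (c : Letter) : tauLetter c =
    (if c = .a then 1 else -1 : ℚ) • letter .a + (if c = .a then 1 else 0 : ℚ) • letter .b := by
  cases c <;> simp [tauLetter]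

theorem mem_slitPlane_of_mem_ball_one {z : ℂ} (hz : z ∈ ball (1 : ℂ) 1) :
    z ∈ Complex.slitPlane := by
  have := Complex.mem_slitPlane_of_norm_lt_one (z := z - 1) (by
    rwa [mem_ball, dist_eq_norm] at hz)
  simpa using this

theorem half_mem_Omega : (1 / 2 : ℂ) ∈ Omega := by
  refine ⟨?_, mem_slitPlane_of_mem_ball_one ?_⟩
  · rw [mem_ball_zero_iff]; norm_num
  · rw [mem_ball, dist_eq_norm]; norm_num

/-- The map `z ↦ 1 - z` fixes `1/2` and preserves the lens of the two unit discs about 0 and 1. On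
both letters the value is `L_a(1/2) + L_b(1/2) = log 2 - log 2 = 0`. -/
theorem isZetaMorphism_box :
    IsZetaMorphism 0 (conv (polylogChar (1 / 2)) (polylogChar (1 / 2) ∘ₗ antiExtend sigmaLetter)) := by
  have hF := isShuffleMorphism_polylogChar half_mem_Omega
  have hab : polylogChar (1 / 2) (letter .a) + polylogChar (1 / 2) (letter .b) = 0 := by
    rw [letter, polylogChar_a_cons, discWord_a half_mem_Omega.1, polylogChar_b half_mem_Omega]
    norm_num
  refine ⟨hF.conv (hF.comp_antiExtend sigmaLetter_eq), fun k r hr => ?_, ?_, ?_⟩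
  · have hcomm : ∀ z ∈ ball (0 : ℂ) 1 ∩ ball 1 1, 1 - z ∈ ball (0 : ℂ) 1 ∩ ball 1 1 := by
      rintro z ⟨h1, h2⟩
      rw [mem_ball, dist_eq_norm] at h1 h2
      refine ⟨?_, ?_⟩
      · rw [mem_ball, dist_eq_norm, sub_zero, norm_sub_rev]
        exact h2
      · rw [mem_ball, dist_eq_norm, sub_sub_cancel_left, norm_neg]
        simpa using h1
    have hO : ball (0 : ℂ) 1 ∩ ball 1 1 ⊆ Omega := fun z hz =>
      ⟨hz.1, mem_slitPlane_of_mem_ball_one hz.2⟩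
    have key := conv_pullback_seqWord (φ := fun z => 1 - z) (φ' := fun _ => -1) (ξ := 1)
      sigmaLetter_eq (by simp) (isOpen_ball.inter isOpen_ball)
      ((convex_ball (0 : ℂ) 1).inter (convex_ball 1 1)) hO (fun z hz => hO (hcomm z hz))
      (fun z _ => by simpa using (hasDerivAt_id z).const_sub 1) (fun z _ => by simp)
      (fun z _ => by simp) (by norm_num) (fun s hs => ?_) ?_ r hr (z := 1 / 2) ?_
    · convert key using 4
      norm_num
    · have h1 := exp_neg_le_third hs
      have h0 := Real.exp_pos (-s)
      have e : rayPath 1 s = ((1 - Real.exp (-s) : ℝ) : ℂ) := by simp [rayPath]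
      rw [e]
      refine ⟨?_, ?_⟩
      · rw [mem_ball_zero_iff, Complex.norm_real, Real.norm_of_nonneg (by linarith)]
        linarith
      · rw [mem_ball, dist_eq_norm, ← Complex.ofReal_one, ← Complex.ofReal_sub, Complex.norm_real,
          sub_sub_cancel_left, norm_neg, Real.norm_of_nonneg h0.le]
        linarith
    · refine IsBigO.of_bound 1 (Eventually.of_forall fun s => ?_)
      have e : 1 - rayPath 1 s = (Real.exp (-s) : ℂ) := by simp [rayPath]
      rw [e, Complex.norm_real, one_mul]
    · refine ⟨half_mem_Omega.1, ?_⟩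
      rw [mem_ball, dist_eq_norm]; norm_num
  · rw [conv_antiExtend_letter hF sigmaLetter_eq]
    simpa using hab
  · rw [conv_antiExtend_letter hF sigmaLetter_eq]
    simpa [add_comm] using hab

/-! ### The points `ρ` and `ρ⁻¹` -/

/-- The point `e^{ε i π / 3}`. -/
def rhoSign (ε : ℝ) : ℂ := Complex.exp ((ε * (Real.pi / 3) : ℝ) * Complex.I)

theorem rho_eq : rho = rhoSign 1 := by
  rw [rho, rhoSign]; congr 1; push_cast; ring

theorem rho_inv_eq : rho⁻¹ = rhoSign (-1) := by
  rw [rho, rhoSign, ← Complex.exp_neg]; congr 1; push_cast; ring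

theorem norm_rhoSign (ε : ℝ) : ‖rhoSign ε‖ = 1 := Complex.norm_exp_ofReal_mul_I _

theorem rhoSign_re {ε : ℝ} (hε : ε = 1 ∨ ε = -1) : (rhoSign ε).re = 1 / 2 := by
  rw [rhoSign, Complex.exp_ofReal_mul_I_re]
  rcases hε with rfl | rfl <;> simp

theorem rhoSign_im {ε : ℝ} (hε : ε = 1 ∨ ε = -1) : (rhoSign ε).im = ε * (√3 / 2) := by
  rw [rhoSign, Complex.exp_ofReal_mul_I_im]
  rcases hε with rfl | rfl <;> simp

theorem one_sub_rhoSign {ε : ℝ} (hε : ε = 1 ∨ ε = -1) : 1 - rhoSign ε = rhoSign (-ε) := by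
  have hε' : -ε = 1 ∨ -ε = -1 := by rcases hε with rfl | rfl <;> simp
  refine Complex.ext ?_ ?_
  · rw [Complex.sub_re, rhoSign_re hε, rhoSign_re hε']; norm_num
  · rw [Complex.sub_im, rhoSign_im hε, rhoSign_im hε']; simp

theorem log_rhoSign {ε : ℝ} (hε : ε = 1 ∨ ε = -1) : Complex.log (rhoSign ε) = ε * (Complex.I * Real.pi / 3) := by
  have hpi := Real.pi_pos
  rw [rhoSign, Complex.log_exp]
  · push_cast; ring
  · rcases hε with rfl | rfl <;> simp <;> linarith
  · rcases hε with rfl | rfl <;> simp <;> linarith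

theorem rhoSign_mem_slitPlane {ε : ℝ} (hε : ε = 1 ∨ ε = -1) : rhoSign ε ∈ Complex.slitPlane :=
  Complex.mem_slitPlane_iff.2 (.inl (by rw [rhoSign_re hε]; norm_num))

theorem half_le_abs_rhoSign_im {ε : ℝ} (hε : ε = 1 ∨ ε = -1) : 1 / 2 ≤ |(rhoSign ε).im| := by
  have h3 : 1 ≤ √3 := Real.one_le_sqrt.2 (by norm_num)
  have h0 : |ε| = 1 := by rcases hε with rfl | rfl <;> simp
  rw [rhoSign_im hε, abs_mul, h0, one_mul, abs_of_nonneg (by positivity)]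
  linarith

/-- The half disc segment `|z| < 1`, `Re z > 1 / 2`, `ε Im z > 0`. -/
def segmentSign (ε : ℝ) : Set ℂ := {z | ‖z‖ < 1 ∧ 1 / 2 < z.re ∧ 0 < ε * z.im}

theorem isOpen_segmentSign (ε : ℝ) : IsOpen (segmentSign ε) :=
  (isOpen_lt continuous_norm continuous_const).inter
    ((isOpen_lt continuous_const Complex.continuous_re).inter
      (isOpen_lt continuous_const (continuous_const.mul Complex.continuous_im)))

theorem norm_add_smul_lt {x y : ℂ} {s t : ℝ} (hx : ‖x‖ ≤ 1) (hy : ‖y‖ < 1) (hs : 0 ≤ s)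
    (ht : 0 < t) (hst : s + t = 1) : ‖s • x + t • y‖ < 1 := by
  calc ‖s • x + t • y‖ ≤ ‖s • x‖ + ‖t • y‖ := norm_add_le _ _
    _ = s * ‖x‖ + t * ‖y‖ := by
      rw [norm_smul, norm_smul, Real.norm_of_nonneg hs, Real.norm_of_nonneg ht.le]
    _ < 1 := by nlinarith

theorem combo_mem_segmentSign {ε : ℝ} {x y : ℂ} {s t : ℝ} (hx : ‖x‖ ≤ 1) (hx' : 1 / 2 ≤ x.re)
    (hx'' : 0 ≤ ε * x.im) (hy : y ∈ segmentSign ε) (hs : 0 ≤ s) (ht : 0 < t) (hst : s + t = 1) :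
    s • x + t • y ∈ segmentSign ε := by
  obtain ⟨h1, h2, h3⟩ := hy
  refine ⟨norm_add_smul_lt hx h1 hs ht hst, ?_, ?_⟩
  · simp only [Complex.add_re, Complex.real_smul, Complex.re_ofReal_mul]
    nlinarith
  · simp only [Complex.add_im, Complex.real_smul, Complex.im_ofReal_mul]
    have : ε * (s * x.im + t * y.im) = s * (ε * x.im) + t * (ε * y.im) := by ring
    rw [this]
    positivity

theorem convex_segmentSign (ε : ℝ) : Convex ℝ (segmentSign ε) := by
  intro x hx y hy s t hs ht hst
  rcases ht.eq_or_lt with rfl | ht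
  · obtain rfl : s = 1 := by linarith
    simpa using hx
  · exact combo_mem_segmentSign hx.1.le hx.2.1.le hx.2.2.le hy hs ht hst

theorem mem_slitPlane_of_mem_segmentSign {ε : ℝ} {z : ℂ} (hz : z ∈ segmentSign ε) :
    z ∈ Complex.slitPlane :=
  Complex.mem_slitPlane_iff.2 (.inl (by linarith [hz.2.1]))

theorem segmentSign_subset (ε : ℝ) : segmentSign ε ⊆ Omega := fun _ hz =>
  ⟨by simpa using hz.1, mem_slitPlane_of_mem_segmentSign hz⟩

/-- `|z - 1| < |z|` amounts to `Re z > 1/2`. A real `z` in `]1/2, 1[` would land on the slit, which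
is why the region is confined to one side of the real axis. -/
theorem one_sub_inv_mem_Omega {ε : ℝ} {z : ℂ} (hz : z ∈ segmentSign ε) : 1 - z⁻¹ ∈ Omega := by
  have hz0 : z ≠ 0 := ne_zero_of_mem_Omega (segmentSign_subset ε hz)
  constructor
  · have e : 1 - z⁻¹ = (z - 1) / z := by field_simp
    rw [mem_ball_zero_iff, e, norm_div, div_lt_one (norm_pos_iff.2 hz0)]
    refine lt_of_pow_lt_pow_left₀ 2 (norm_nonneg _) ?_
    rw [Complex.sq_norm, Complex.sq_norm, Complex.normSq_apply, Complex.normSq_apply]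
    simp only [Complex.sub_re, Complex.sub_im, Complex.one_re, Complex.one_im]
    nlinarith [hz.2.1]
  · refine Complex.mem_slitPlane_iff.2 (.inr fun h => ?_)
    have him : z.im ≠ 0 := fun h0 => by simpa [h0] using hz.2.2
    rw [Complex.sub_im, Complex.one_im, Complex.inv_im, zero_sub, neg_div, neg_neg,
      div_eq_zero_iff] at h
    exact h.elim him (Complex.normSq_pos.2 hz0).ne'

theorem rayPath_mem_segmentSign {ε : ℝ} (hε : ε = 1 ∨ ε = -1) {s : ℝ} (hs : 2 ≤ s) :
    rayPath (1 - ε * Complex.I) s ∈ segmentSign ε := by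
  have h1 := exp_neg_le_third hs
  have h0 := Real.exp_pos (-s)
  have hε2 : ε * ε = 1 := by rcases hε with rfl | rfl <;> norm_num
  have hre : (rayPath (1 - ε * Complex.I) s).re = 1 - Real.exp (-s) := by
    rw [rayPath, Complex.sub_re, Complex.re_ofReal_mul]; simp
  have him : (rayPath (1 - ε * Complex.I) s).im = Real.exp (-s) * ε := by
    rw [rayPath, Complex.sub_im, Complex.im_ofReal_mul]; simp
  refine ⟨?_, ?_, ?_⟩
  · refine lt_of_pow_lt_pow_left₀ 2 zero_le_one ?_
    rw [Complex.sq_norm, Complex.normSq_apply, hre, him]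
    nlinarith
  · rw [hre]; linarith
  · rw [him]; nlinarith

theorem norm_one_sub_sign_mul_I_le {ε : ℝ} (hε : ε = 1 ∨ ε = -1) :
    ‖1 - ε * Complex.I‖ ≤ 3 / 2 := by
  refine (pow_le_pow_iff_left₀ (norm_nonneg _) (by norm_num) two_ne_zero).1 ?_
  rw [Complex.sq_norm, Complex.normSq_apply]
  rcases hε with rfl | rfl <;> norm_num

theorem conv_tau_segmentSign {ε : ℝ} (hε : ε = 1 ∨ ε = -1) {k : ℕ} (r : Fin (k + 1) → ℕ+)
    (hr : 2 ≤ r (Fin.last k)) {z : ℂ} (hz : z ∈ segmentSign ε) :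
    conv (polylogChar z) (polylogChar (1 - z⁻¹) ∘ₗ antiExtend tauLetter) (word (seqWord r)) =
      polyzetaSeries r := by
  have hne : ∀ z ∈ segmentSign ε, z ≠ 0 ∧ 1 - z ≠ 0 := fun z hz =>
    ⟨ne_zero_of_mem_Omega (segmentSign_subset ε hz),
      one_sub_ne_zero_of_mem_ball (segmentSign_subset ε hz).1⟩
  refine conv_pullback_seqWord (φ := fun z => 1 - z⁻¹) (φ' := fun z => (z ^ 2)⁻¹)
    (ξ := 1 - ε * Complex.I) tauLetter_eq (by simp) (isOpen_segmentSign ε) (convex_segmentSign ε)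
    (segmentSign_subset ε) (fun z hz => one_sub_inv_mem_Omega hz) (fun z hz => ?_)
    (fun z hz => ?_) (fun z hz => ?_) (norm_one_sub_sign_mul_I_le hε)
    (fun s hs => rayPath_mem_segmentSign hε hs) ?_ r hr hz
  · simpa using (hasDerivAt_inv (hne z hz).1).const_sub 1
  · obtain ⟨h1, h2⟩ := hne z hz
    have e : 1 - z⁻¹ = -(1 - z) / z := by field_simp; ring
    simp only [if_true, Rat.cast_one, one_mul, e]
    field_simp
    ring
  · obtain ⟨h1, h2⟩ := hne z hz
    simp only [reduceCtorEq, if_false, sub_sub_cancel, inv_inv, Rat.cast_neg, Rat.cast_one,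
      Rat.cast_zero, zero_mul, add_zero]
    field_simp
  · refine IsBigO.of_bound 3 ?_
    filter_upwards [eventually_ge_atTop 2] with s hs
    have hs' := rayPath_mem_segmentSign hε hs
    have h0 := (hne _ hs').1
    have e : 1 - (rayPath (1 - ε * Complex.I) s)⁻¹ =
        -(Real.exp (-s) * (1 - ε * Complex.I)) / rayPath (1 - ε * Complex.I) s := by
      field_simp
      rw [rayPath]
      ring
    have h1 : 1 / 2 ≤ ‖rayPath (1 - ε * Complex.I) s‖ :=
      hs'.2.1.le.trans (Complex.re_le_norm _)
    rw [e, norm_div, norm_neg, norm_mul, Complex.norm_real, div_le_iff₀ (norm_pos_iff.2 h0)]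
    have h2 := norm_one_sub_sign_mul_I_le hε
    have h3 : 0 ≤ ‖Real.exp (-s)‖ := norm_nonneg _
    nlinarith

theorem neBot_nhdsWithin_segmentSign {ε : ℝ} (hε : ε = 1 ∨ ε = -1) :
    (𝓝[segmentSign ε] (rhoSign ε)).NeBot := by
  have hq := rayPath_mem_segmentSign hε le_rfl
  set q := rayPath (1 - ε * Complex.I) 2
  have h1 : Tendsto (fun t : ℝ => (1 - t) • rhoSign ε + t • q) (𝓝[>] 0) (𝓝 (rhoSign ε)) := by
    have : ContinuousAt (fun t : ℝ => (1 - t) • rhoSign ε + t • q) 0 := by fun_prop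
    have := this.tendsto.mono_left (nhdsWithin_le_nhds (s := Set.Ioi (0 : ℝ)))
    simpa using this
  have h2 : Tendsto (fun t : ℝ => (1 - t) • rhoSign ε + t • q) (𝓝[>] 0)
      (𝓝[segmentSign ε] (rhoSign ε)) := by
    refine tendsto_nhdsWithin_iff.2 ⟨h1, ?_⟩
    filter_upwards [Ioo_mem_nhdsGT (zero_lt_one (α := ℝ))] with t ht
    refine combo_mem_segmentSign (norm_rhoSign ε).le (rhoSign_re hε).ge ?_ hq
      (by linarith [ht.2]) ht.1 (by ring)
    rw [rhoSign_im hε, ← mul_assoc]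
    have hε2 : ε * ε = 1 := by rcases hε with rfl | rfl <;> norm_num
    rw [hε2]
    positivity
  exact h2.neBot

theorem exists_isZetaMorphism_nabla {ε : ℝ} (hε : ε = 1 ∨ ε = -1) : ∃ ψ : H →ₗ[ℚ] ℂ,
    IsShuffleMorphism ψ ∧
    (𝓝[Omega] (rhoSign ε)).NeBot ∧
    (∀ h, Tendsto (fun z => polylogChar z h) (𝓝[Omega] (rhoSign ε)) (𝓝 (ψ h))) ∧
    IsZetaMorphism (ε * (Complex.I * Real.pi)) (conv ψ (ψ ∘ₗ antiExtend tauLetter)) := by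
  have hε' : -ε = 1 ∨ -ε = -1 := by rcases hε with rfl | rfl <;> simp
  obtain ⟨hne, ψ, hψ, hlim⟩ := exists_limit_polylogChar (p := rhoSign ε)
    (by rw [one_sub_rhoSign hε, norm_rhoSign]) (norm_rhoSign ε) (half_le_abs_rhoSign_im hε)
  have hb : ψ (letter .b) = ε * (Complex.I * Real.pi / 3) := by
    rw [← log_rhoSign hε]
    refine tendsto_nhds_unique (hlim (letter .b)) ?_
    refine ((continuousAt_clog (rhoSign_mem_slitPlane hε)).tendsto.mono_left
      nhdsWithin_le_nhds).congr' ?_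
    filter_upwards [self_mem_nhdsWithin] with z hz
    exact (polylogChar_b hz).symm
  have ha : ψ (letter .a) = ε * (Complex.I * Real.pi / 3) := by
    have h1 : -Complex.log (1 - rhoSign ε) = ε * (Complex.I * Real.pi / 3) := by
      rw [one_sub_rhoSign hε, log_rhoSign hε']
      push_cast
      ring
    rw [← h1]
    refine tendsto_nhds_unique (hlim (letter .a)) ?_
    have h2 : ContinuousAt (fun z => -Complex.log (1 - z)) (rhoSign ε) := by
      refine (ContinuousAt.clog (by fun_prop) ?_).neg
      rw [one_sub_rhoSign hε]
      exact rhoSign_mem_slitPlane hε'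
    refine (h2.tendsto.mono_left nhdsWithin_le_nhds).congr' ?_
    filter_upwards [self_mem_nhdsWithin] with z hz
    rw [letter, polylogChar_a_cons, discWord_a hz.1]
  refine ⟨ψ, hψ, hne, hlim, hψ.conv (hψ.comp_antiExtend tauLetter_eq), fun k r hr => ?_, ?_, ?_⟩
  · have hne' := neBot_nhdsWithin_segmentSign hε
    have hp0 : rhoSign ε ≠ 0 := norm_ne_zero_iff.1 (by rw [norm_rhoSign]; exact one_ne_zero)
    -- Because the point is fixed, both factors of the identity on the segment converge to values of
    -- the same `ψ`.
    have hfix : 1 - (rhoSign ε)⁻¹ = rhoSign ε := by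
      have : (rhoSign ε)⁻¹ = rhoSign (-ε) := by
        rw [rhoSign, rhoSign, ← Complex.exp_neg]
        congr 1
        push_cast
        ring
      rw [this, ← one_sub_rhoSign hε, sub_sub_cancel]
    have hid : 𝓝[segmentSign ε] (rhoSign ε) ≤ 𝓝[Omega] (rhoSign ε) :=
      nhdsWithin_mono _ (segmentSign_subset ε)
    have hφ : Tendsto (fun z : ℂ => 1 - z⁻¹) (𝓝[segmentSign ε] (rhoSign ε))
        (𝓝[Omega] (rhoSign ε)) := by
      refine tendsto_nhdsWithin_iff.2 ⟨?_, ?_⟩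
      · have h1 : ContinuousAt (fun z : ℂ => 1 - z⁻¹) (rhoSign ε) :=
          continuousAt_const.sub (continuousAt_inv₀ hp0)
        have h2 := h1.tendsto.mono_left (nhdsWithin_le_nhds (s := segmentSign ε))
        rwa [hfix] at h2
      · filter_upwards [self_mem_nhdsWithin] with z hz using one_sub_inv_mem_Omega hz
    have h1 : Tendsto (fun z => conv (polylogChar z)
        (polylogChar (1 - z⁻¹) ∘ₗ antiExtend tauLetter) (word (seqWord r)))
        (𝓝[segmentSign ε] (rhoSign ε))
        (𝓝 (conv ψ (ψ ∘ₗ antiExtend tauLetter) (word (seqWord r)))) := by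
      simp only [conv_word_eq_sum, LinearMap.comp_apply]
      exact tendsto_finsetSum _ fun i _ =>
        ((hlim _).mono_left hid).mul ((hlim _).comp hφ)
    refine tendsto_nhds_unique h1 (tendsto_const_nhds.congr' ?_)
    filter_upwards [self_mem_nhdsWithin] with z hz using (conv_tau_segmentSign hε r hr hz).symm
  -- On `a` the value is `2ψ(a) + ψ(b)`, three times `ε iπ/3`; on `b` it is `ψ(b) - ψ(a) = 0`.
  · rw [conv_antiExtend_letter hψ tauLetter_eq, ha, hb]
    simp only [if_true, Rat.cast_one]
    ring
  · rw [conv_antiExtend_letter hψ tauLetter_eq, ha, hb]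
    simp

end Polyzeta

end

open Polyzeta Filter Topology in
theorem theorem7 :
    -- the morphisms `h ↦ L_h`, `ζ`, `ζ⁺`, `ζ⁻` are well defined by their requirements
    ((∃! Φ, IsPolylogMorphism Φ) ∧ IsPolylogMorphism polylog) ∧
    ((∃! ψ, IsZetaMorphism 0 ψ) ∧ IsZetaMorphism 0 zeta) ∧
    ((∃! ψ, IsZetaMorphism (Complex.I * Real.pi) ψ) ∧
      IsZetaMorphism (Complex.I * Real.pi) zetaPlus) ∧
    ((∃! ψ, IsZetaMorphism (-(Complex.I * Real.pi)) ψ) ∧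
      IsZetaMorphism (-(Complex.I * Real.pi)) zetaMinus) ∧
    ∀ h : H,
      zeta h = L (boxMap h) (1 / 2) ∧
      -- the continuous extension to `ρ` and to `ρ⁻¹` exists and takes the stated value
      (Tendsto (polylog (nablaMap h)).1 (comap ((↑) : Omega → ℂ) (𝓝 rho))
          (𝓝 (L (nablaMap h) rho)) ∧
        zetaPlus h = L (nablaMap h) rho) ∧
      (Tendsto (polylog (nablaMap h)).1 (comap ((↑) : Omega → ℂ) (𝓝 rho⁻¹))
          (𝓝 (L (nablaMap h) rho⁻¹)) ∧
        zetaMinus h = L (nablaMap h) rho⁻¹) := by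
  obtain ⟨ψ₁, hψ₁, hne₁, hlim₁, hz₁⟩ := exists_isZetaMorphism_nabla (ε := 1) (.inl rfl)
  obtain ⟨ψ₂, hψ₂, hne₂, hlim₂, hz₂⟩ := exists_isZetaMorphism_nabla (ε := -1) (.inr rfl)
  simp only [Complex.ofReal_one, Complex.ofReal_neg, one_mul, neg_mul] at hz₁ hz₂
  have hnot : ∀ ε, rhoSign ε ∉ Omega := fun ε hε => by
    have := mem_ball_of_mem_Omega hε
    simp [norm_rhoSign] at this
  refine ⟨⟨existsUnique_isPolylogMorphism, isPolylogMorphism_polylog⟩,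
    ⟨isZetaMorphism_box.existsUnique, isZetaMorphism_box.epsilon⟩,
    ⟨hz₁.existsUnique, hz₁.epsilon⟩, ⟨hz₂.existsUnique, hz₂.epsilon⟩, fun h => ⟨?_, ?_, ?_⟩⟩
  · rw [L_of_mem _ half_mem_Omega, boxMap, sigma,
      map_lift_shuffle_coproduct (isShuffleMorphism_polylogChar half_mem_Omega)]
    exact LinearMap.congr_fun (isZetaMorphism_box.epsilon.unique isZetaMorphism_box) h
  · rw [rho_eq]
    have hL := L_of_tendsto (hnot 1) (hlim₁ (nablaMap h))
    refine ⟨hL ▸ tendsto_polylog (hlim₁ _), ?_⟩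
    rw [hL, nablaMap, tau, map_lift_shuffle_coproduct hψ₁]
    exact LinearMap.congr_fun (hz₁.epsilon.unique hz₁) h
  · rw [rho_inv_eq]
    have hL := L_of_tendsto (hnot (-1)) (hlim₂ (nablaMap h))
    refine ⟨hL ▸ tendsto_polylog (hlim₂ _), ?_⟩
    rw [hL, nablaMap, tau, map_lift_shuffle_coproduct hψ₂]
    exact LinearMap.congr_fun (hz₂.epsilon.unique hz₂) h
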